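/- Let $N\ge 1$, $T\ge 0$, and let $(\Omega,\mathcal F,\mathbb Q)$ be a probability space carrying two independent processes $X$ and $Y$: * $X=(X_t)_{t\ge0}$ is a càdlàg Markov chain with values in the standard basis $\mathcal X=\{e_1,\dots,e_N\}$ of $\mathbb R^N$ and rate matrices $(A_t)_{t\ge 0}$, where $(A_t)_{ij}$ is the rate of jumping from state $j$ to state $i$ (nonnegative off-diagonal entries, columns summing to $0$), with $t\mapsto A_t$ locally integrable; that is, $X_t-X_0-\int_{]0,t]}A_uX_u\,du$ is a martingale in the filtration generated by $X$. * $Y$ is a standard (unit rate) Poisson process whose paths are counting paths (nonnegative-integer-valued, increasing, right-constant, with jumps of size at most $1$). Write $\mathbb D$ for the space of counting paths. Put $\mathcal Y_t=\sigma(Y_s;s\le t)$ and $\mathcal F_t=\mathcal Y_t\vee\sigma(X_s;s\le t)$. Let $\lambda:\mathcal X\times[0,\infty[\,\times\,\mathbb D\to\,]0,\infty[$ be a rate function such that $\lambda(e_i,\cdot,\cdot)$ is predictable (for the filtration generated by the coordinate process on $\mathbb D$) for every $i$, such that $s\mapsto\lambda(X_{s-},s,Y)$ is left continuous, and such that almost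 surely $\int_0^T\lambda(e_i,u,Y)\,du<\infty$ for every $i$. Write $\lambda_u=\lambda(X_{u-},u,Y)$, let $\Lambda_u$ be the diagonal matrix with entries $\lambda(e_i,u,Y)$, and let $$Z_t=\exp\Big(-\int_{]0,t]}(\lambda_u-1)\,du\Big)\prod_{u\in]0,t]}\lambda_u^{\Delta Y_u}.$$ Assume that $(Z_t)_{0\le t\le T}$ is a $(\mathbb Q,\mathcal F_t)$-martingale. For $0\le t\le T$ define the unnormalized filtered and smoothed densities $$q_t=E_{\mathbb Q}[Z_tX_t\mid\mathcal Y_t],\qquad r_t=E_{\mathbb Q}[Z_TX_t\mid\mathcal Y_T].$$ Then there is a family $(v_t)_{0\le t\le T}$ of $\mathcal Y_T$-measurable random vectors in $\mathbb R^N$ such that, for every $t\in[0,T]$, $$r_t=\mathrm{diag}(v_t)\,q_t\quad\text{almost surely},$$ and such that, almost surely, $t\mapsto v_t$ is càdlàg on $[0,T]$ and satisfies $$dv_t=-(A_t^\top-\Lambda_t+I)\,v_{t-}\,dt+(\Lambda_t^{-1}-I)\,v_{t-}\,dY_t,\qquad v_T=\mathbf 1,$$ that is, $v_T=\mathbf 1$,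 the integrand $(A_u^\top-\Lambda_u+I)v_{u-}$ is integrable on $[0,T]$, and for all $t\in[0,T]$ $$v_t=v_0-\int_{]0,t]}(A_u^\top-\Lambda_u+I)v_{u-}\,du+\int_{]0,t]}(\Lambda_u^{-1}-I)v_{u-}\,dY_u.$$ -/

import Mathlib

open MeasureTheory ProbabilityTheory Filter Function
open scoped NNReal Topology Matrix

noncomputable section

/-- A path of a counting process: an integer-valued, increasing, right-constant function of time
whose jumps are at most `1`. -/
structure CountingPath where
  toFun : ℝ≥0 → ℕ
  monotone : Monotone toFun
  right_constant : ∀ t, ∀ᶠ s in 𝓝[>] t, toFun s = toFun t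
  jump_le_one : ∀ t, toFun t ≤ leftLim toFun t + 1

namespace CountingPath

instance : CoeFun CountingPath (fun _ => ℝ≥0 → ℕ) := ⟨toFun⟩

/-- The jump times of `y` in `]0,t]` form a finite set. -/
theorem finite_jumps (y : CountingPath) (t : ℝ≥0) :
    {u : ℝ≥0 | 0 < u ∧ u ≤ t ∧ leftLim y u ≠ y u}.Finite := by
  refine Set.Finite.of_injOn (f := y) (t := Set.Iic (y t)) ?_ ?_ (Set.finite_Iic _)
  · intro u hu
    exact y.monotone hu.2.1
  · apply StrictMonoOn.injOn
    intro s _ u hu hsu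
    have h1 : y s ≤ leftLim y u := y.monotone.le_leftLim hsu
    have h2 : leftLim y u ≤ y u := y.monotone.leftLim_le le_rfl
    exact lt_of_le_of_lt h1 (lt_of_le_of_ne h2 hu.2.2)

/-- The finite set of jump times of `y` in `]0,t]`. For a counting path `y`, the integral
`∫_{]0,t]} f_u dy_u` is `∑ u ∈ y.jumps t, f u`. -/
def jumps (y : CountingPath) (t : ℝ≥0) : Finset ℝ≥0 := (y.finite_jumps t).toFinset

/-- The σ-algebra on path space generated by the coordinates. -/
instance : MeasurableSpace CountingPath := ⨆ t : ℝ≥0, MeasurableSpace.comap (fun y => y t) ⊤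

theorem measurable_coord (t : ℝ≥0) : Measurable (fun y : CountingPath => y t) := by
  rw [measurable_iff_comap_le]
  exact le_iSup (fun t : ℝ≥0 => MeasurableSpace.comap (fun y : CountingPath => y t) ⊤) t

/-- The filtration on path space generated by the coordinate process. -/
def filtration : Filtration ℝ≥0 (inferInstance : MeasurableSpace CountingPath) :=
  Filtration.natural (fun t (y : CountingPath) => y t)
    (fun t => (measurable_coord t).stronglyMeasurable)

end CountingPath

section Model

variable {Ω : Type*} [mΩ : MeasurableSpace Ω] {N : ℕ}

/-- The state `i` regarded as the standard basis vector `e_i`. -/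
def stateVec (i : Fin N) : Fin N → ℝ := Pi.single i 1

/-- The filtration `𝒴_t = σ(Y_s; s ≤ t)`. -/
def obsFiltration (Y : Ω → CountingPath) (hY : ∀ t, Measurable (fun ω => Y ω t)) :
    Filtration ℝ≥0 mΩ :=
  Filtration.natural (fun t ω => Y ω t) (fun t => (hY t).stronglyMeasurable)

/-- The filtration `σ(X_s; s ≤ t)`. -/
def stateFiltration (X : ℝ≥0 → Ω → Fin N) (hX : ∀ t, Measurable (X t)) :
    Filtration ℝ≥0 mΩ :=
  Filtration.natural X (fun t => (hX t).stronglyMeasurable)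

/-- The filtration `ℱ_t = 𝒴_t ∨ σ(X_s; s ≤ t)`. -/
def fullFiltration (X : ℝ≥0 → Ω → Fin N) (hX : ∀ t, Measurable (X t))
    (Y : Ω → CountingPath) (hY : ∀ t, Measurable (fun ω => Y ω t)) :
    Filtration ℝ≥0 mΩ :=
  obsFiltration Y hY ⊔ stateFiltration X hX

/-- A family of rate matrices: `A t i j` is the rate of jumping from state `j` to state `i` at
time `t` (so columns sum to `0`), locally integrable in time. -/
structure IsRateMatrix (A : ℝ≥0 → Matrix (Fin N) (Fin N) ℝ) : Prop where
  nonneg : ∀ t i j, i ≠ j → 0 ≤ A t i j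
  col_sum : ∀ t j, ∑ i, A t i j = 0
  integrable : ∀ i j, ∀ t : ℝ≥0,
    IntervalIntegrable (fun u : ℝ => A u.toNNReal i j) volume 0 t

/-- `X` is a càdlàg Markov chain with rate matrix `A` under `Q`, characterised through its
martingale problem: `M_t = X_t - X_0 - ∫_{]0,t]} A_u X_u du` is a martingale. -/
structure IsMarkovChain (Q : Measure Ω) (A : ℝ≥0 → Matrix (Fin N) (Fin N) ℝ)
    (X : ℝ≥0 → Ω → Fin N) (hX : ∀ t, Measurable (X t)) : Prop where
  right_constant : ∀ ω t, ∀ᶠ s in 𝓝[>] t, X s ω = X t ω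
  left_limit : ∀ ω t, ∃ i, ∀ᶠ s in 𝓝[<] t, X s ω = i
  martingale : Martingale
    (fun (t : ℝ≥0) ω => stateVec (X t ω) - stateVec (X 0 ω)
      - ∫ u in (0 : ℝ)..t, A u.toNNReal *ᵥ stateVec (X u.toNNReal ω))
    (stateFiltration X hX) Q

/-- `Y` is a standard (unit rate) Poisson process under `Q`. -/
structure IsStandardPoisson (Q : Measure Ω) (Y : Ω → CountingPath) : Prop where
  zero : ∀ᵐ ω ∂Q, Y ω 0 = 0
  indep : HasIndepIncrements (fun t ω => Y ω t) Q
  law : ∀ s t : ℝ≥0, s ≤ t → HasLaw (fun ω => Y ω t - Y ω s) (poissonMeasure (t - s)) Q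

/-- The processes `X` and `Y` are independent under `Q`. -/
def IndepProcesses (Q : Measure Ω) (X : ℝ≥0 → Ω → Fin N) (Y : Ω → CountingPath) : Prop :=
  IndepFun (fun ω t => X t ω) (fun ω t => Y ω t) Q

/-- The intensity `λ_u = λ(X_{u-}, u, Y)` along the path `ω`. -/
def intensity (lam : Fin N → ℝ≥0 → CountingPath → ℝ) (X : ℝ≥0 → Ω → Fin N)
    (Y : Ω → CountingPath) (u : ℝ≥0) (ω : Ω) : ℝ :=
  lam (leftLim (fun s => X s ω) u) u (Y ω)

/-- `lam` is an admissible rate function on `[0,T]` for the counting process: strictly positive,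
predictable in the filtration of the counting path, left continuous along the path of
`(X_{s-}, Y)`, and integrable on `[0,T]` in every state. -/
structure IsRateFunction (Q : Measure Ω) (lam : Fin N → ℝ≥0 → CountingPath → ℝ)
    (X : ℝ≥0 → Ω → Fin N) (Y : Ω → CountingPath) (T : ℝ≥0) : Prop where
  pos : ∀ i t y, 0 < lam i t y
  predictable : ∀ i, Measurable[CountingPath.filtration.predictable]
    (fun p : ℝ≥0 × CountingPath => lam i p.1 p.2)
  left_continuous : ∀ ω t, ContinuousWithinAt (fun s => intensity lam X Y s ω) (Set.Iic t) t
  integrable : ∀ i, ∀ᵐ ω ∂Q,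
    IntervalIntegrable (fun u : ℝ => lam i u.toNNReal (Y ω)) volume 0 T

/-- The likelihood process
`Z_t = exp(-∫_{]0,t]} (λ_u - 1) du) ∏_{u ∈ ]0,t]} λ_u^{ΔY_u}`. -/
def likelihood (lam : Fin N → ℝ≥0 → CountingPath → ℝ) (X : ℝ≥0 → Ω → Fin N)
    (Y : Ω → CountingPath) (t : ℝ≥0) (ω : Ω) : ℝ :=
  Real.exp (-∫ u in (0 : ℝ)..t, (intensity lam X Y u.toNNReal ω - 1))
    * ∏ u ∈ (Y ω).jumps t, intensity lam X Y u ω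

/-- The diagonal matrix `Λ_u` with entries `λ(e_i, u, y)`. -/
def rateDiag (lam : Fin N → ℝ≥0 → CountingPath → ℝ) (y : CountingPath) (u : ℝ≥0) :
    Matrix (Fin N) (Fin N) ℝ :=
  Matrix.diagonal (fun i => lam i u y)

/-- The unnormalised filter `q_t = E_Q[Z_t X_t | 𝒴_t]`. -/
def filterDensity (Q : Measure Ω) (lam : Fin N → ℝ≥0 → CountingPath → ℝ)
    (X : ℝ≥0 → Ω → Fin N) (Y : Ω → CountingPath) (hY : ∀ t, Measurable (fun ω => Y ω t))
    (t : ℝ≥0) : Ω → Fin N → ℝ :=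
  Q[fun ω => likelihood lam X Y t ω • stateVec (X t ω) | obsFiltration Y hY t]

/-- The unnormalised smoother `r_t = E_Q[Z_T X_t | 𝒴_T]`. -/
def smoothedDensity (Q : Measure Ω) (lam : Fin N → ℝ≥0 → CountingPath → ℝ)
    (X : ℝ≥0 → Ω → Fin N) (Y : Ω → CountingPath) (hY : ∀ t, Measurable (fun ω => Y ω t))
    (T t : ℝ≥0) : Ω → Fin N → ℝ :=
  Q[fun ω => likelihood lam X Y T ω • stateVec (X t ω) | obsFiltration Y hY T]

end Model

/-- The path `v` is càdlàg on `[0,T]` and solves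
`dv_t = -(A_tᵀ - L_t + I) v_{t-} dt + (L_t⁻¹ - I) v_{t-} dy_t`, `v_T = 𝟏`,
in integrated form on `[0,T]`, with integrable drift. -/
structure SolvesBackward {N : ℕ} (A L : ℝ≥0 → Matrix (Fin N) (Fin N) ℝ) (y : CountingPath)
    (T : ℝ≥0) (v : ℝ≥0 → Fin N → ℝ) : Prop where
  right_continuous : ∀ t, t < T → ContinuousWithinAt v (Set.Ici t) t
  left_limit : ∀ t, t ≤ T → ∃ l, Tendsto v (𝓝[<] t) (𝓝 l)
  terminal : v T = 1
  integrable : IntervalIntegrable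
    (fun u : ℝ => (((A u.toNNReal)ᵀ - L u.toNNReal + 1) *ᵥ leftLim v u.toNNReal : Fin N → ℝ))
    volume 0 T
  equation : ∀ t, t ≤ T → v t = v 0
    - (∫ u in (0 : ℝ)..t, ((A u.toNNReal)ᵀ - L u.toNNReal + 1) *ᵥ leftLim v u.toNNReal)
    + ∑ u ∈ y.jumps t, ((L u)⁻¹ - 1) *ᵥ leftLim v u

end

/-!
The smoother is obtained from the filter by a backward equation that is solved path by path, the
observation path `y` being held fixed.

Independence of `X` and `Y` reduces the statement to a fixed `y`: conditioning `Z_t X_s` on the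
observations up to time `t` integrates out the state process (`condExp_likelihood_smul_stateVec`,
from `condExp_comap_of_indepFun`). It remains to find, for each `y`, a càdlàg path `v` solving the
backward equation with
`E[Z_T X_t] = diag(v_t) E[Z_t X_t]`, where `Z` is computed from `y` and the random `X`.

The equation is put in integral form against the measure that adds the jumps of `y` to Lebesgue
measure on `]0,T]` (`CountingPath.drivingMeasure`). At a jump `v_{u-} = Λ_u v_u`, so
`(Λ_u⁻¹ - 1) v_{u-} = (1 - Λ_u) v_u`, and the equation reads `v_t = 𝟏 + ∫_{]t,T]} K_u v_u`, with
`K = Aᵀ - Λ + 1` on the Lebesgue part and `K = Λ - 1` at the jumps (`backwardGenerator`): only the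
values of `v` after `t` enter. Its Picard series converges because the `n`-fold iterated integral is
at most the `n`-th power of the total mass divided by `n!`, atoms or not
(`factorial_mul_simplexMass_le`), and the sum is measurable in the observations
(`exists_backward_volterra`, `exists_backward_solution`). `SolvesBackward.of_eq_integral` returns to
the differential form.

The identity `E[Z_T X_t] = diag(v_t) E[Z_t X_t]` is `IsMarkovChain.integral_pathLikelihood`. With
`v^j` the components of `v`, let `H^j_s = Z_s v^j_s 1_{X_t = e_i}`. Each `H^j` is an integral
against the driving measure, with adapted integrand, and integration by parts against the
martingale problem of `X` (`IsMarkovChain.integral_add_mul_stateVec`) gives the evolution of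
`E[∑_j H^j_s X^j_s]`. The terms containing the rates cancel
(`sum_logRate_mul_sub_backwardGenerator_mul`), and the remaining drift `-Aᵀ v` is balanced by the
jumps of `X`. Hence the mean is constant on `[t,T]`, and its values at `T`, where `v_T = 𝟏`, and at
`t` are the two sides of the identity. The density of `Z` involves `X_{u-}`, which is replaced by
`X_u` because `X` has almost surely no jump at a fixed time (`IsMarkovChain.leftLim_ae_eq`). For
almost every `y` the finitely many rates are integrable on `[0,T]`; then `Z` is bounded uniformly
over the paths of `X`, and no integrability question arises.
-/

noncomputable section

open scoped ENNReal Nat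

/-! ### Integration by parts for indefinite integrals along a time map -/

section ByParts

variable {S : Type*} [MeasurableSpace S] {τ : S → ℝ≥0} {μ : Measure S} {α β : S → ℝ}

/-- Fubini, with the square split by the order of the two times. Pairs with equal times, which have
positive mass when `μ` has atoms, are counted in the second term. -/
theorem integral_mul_integral_eq_add [SFinite μ] (hτ : Measurable τ) (hα : Integrable α μ)
    (hβ : Integrable β μ) :
    (∫ z, α z ∂μ) * ∫ z, β z ∂μ
      = ∫ z, ((∫ w in {w | τ w < τ z}, α w ∂μ) * β z
          + (∫ w in {w | τ w ≤ τ z}, β w ∂μ) * α z) ∂μ := by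
  have hset : MeasurableSet {p : S × S | τ p.1 < τ p.2} :=
    measurableSet_lt (hτ.comp measurable_fst) (hτ.comp measurable_snd)
  have hset' : MeasurableSet {p : S × S | τ p.2 ≤ τ p.1} :=
    measurableSet_le (hτ.comp measurable_snd) (hτ.comp measurable_fst)
  have hint : Integrable (fun p : S × S => α p.1 * β p.2) (μ.prod μ) := hα.mul_prod hβ
  have h1 := hint.indicator hset
  have h2 := hint.indicator hset'
  have hsum : (fun p : S × S => α p.1 * β p.2)
      = fun p => {p : S × S | τ p.1 < τ p.2}.indicator (fun p => α p.1 * β p.2) p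
        + {p : S × S | τ p.2 ≤ τ p.1}.indicator (fun p => α p.1 * β p.2) p := by
    ext p
    by_cases h : τ p.1 < τ p.2
    · simp [Set.indicator, h]
    · simp [Set.indicator, h, not_lt.1 h]
  have e1 : ∀ z, ∫ w, {p : S × S | τ p.1 < τ p.2}.indicator (fun p => α p.1 * β p.2) (w, z) ∂μ
      = (∫ w in {w | τ w < τ z}, α w ∂μ) * β z := by
    intro z
    rw [← integral_indicator (measurableSet_lt hτ measurable_const), ← integral_mul_const]
    congr 1 with w
    by_cases h : τ w < τ z <;> simp [Set.indicator, h]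
  have e2 : ∀ z, ∫ w, {p : S × S | τ p.2 ≤ τ p.1}.indicator (fun p => α p.1 * β p.2) (z, w) ∂μ
      = (∫ w in {w | τ w ≤ τ z}, β w ∂μ) * α z := by
    intro z
    rw [← integral_indicator (measurableSet_le hτ measurable_const), ← integral_mul_const]
    congr 1 with w
    by_cases h : τ w ≤ τ z <;> simp [Set.indicator, h, mul_comm]
  rw [← integral_prod_mul, hsum, integral_add h1 h2, integral_prod_symm _ h1, integral_prod _ h2]
  simp only [e1, e2]
  rw [← integral_add]
  · simpa only [e1] using h1.integral_prod_right
  · simpa only [e2] using h2.integral_prod_left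

/-- The product rule for two functions of bounded variation, given as indefinite integrals along
the time map `τ`: the left limit of the first factor and the value of the second one appear. -/
theorem add_integral_mul_add_integral [SFinite μ] (hτ : Measurable τ) (s : ℝ≥0) (a b : ℝ)
    (hα : IntegrableOn α {z | τ z ≤ s} μ) (hβ : IntegrableOn β {z | τ z ≤ s} μ) :
    (a + ∫ z in {z | τ z ≤ s}, α z ∂μ) * (b + ∫ z in {z | τ z ≤ s}, β z ∂μ)
      = a * b + ∫ z in {z | τ z ≤ s}, ((a + ∫ w in {w | τ w < τ z}, α w ∂μ) * β z
          + (b + ∫ w in {w | τ w ≤ τ z}, β w ∂μ) * α z) ∂μ ∧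
    IntegrableOn (fun z => (a + ∫ w in {w | τ w < τ z}, α w ∂μ) * β z
          + (b + ∫ w in {w | τ w ≤ τ z}, β w ∂μ) * α z) {z | τ z ≤ s} μ := by
  have hms : MeasurableSet {z | τ z ≤ s} := measurableSet_le hτ measurable_const
  have key := integral_mul_integral_eq_add hτ hα hβ
  have hI : Set.EqOn (fun z => (a + ∫ w in {w | τ w < τ z}, α w ∂μ) * β z
          + (b + ∫ w in {w | τ w ≤ τ z}, β w ∂μ) * α z)
      (fun z => ((∫ w in {w | τ w < τ z}, α w ∂(μ.restrict {z | τ z ≤ s})) * β z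
          + (∫ w in {w | τ w ≤ τ z}, β w ∂(μ.restrict {z | τ z ≤ s})) * α z)
            + (a * β z + b * α z)) {z | τ z ≤ s} := by
    intro z (hz : τ z ≤ s)
    have e1 : (μ.restrict {z | τ z ≤ s}).restrict {w | τ w < τ z}
        = μ.restrict {w | τ w < τ z} := by
      rw [Measure.restrict_restrict (measurableSet_lt hτ measurable_const)]
      congr 1
      ext w
      simpa using fun h : τ w < τ z => h.le.trans hz
    have e2 : (μ.restrict {z | τ z ≤ s}).restrict {w | τ w ≤ τ z}
        = μ.restrict {w | τ w ≤ τ z} := by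
      rw [Measure.restrict_restrict (measurableSet_le hτ measurable_const)]
      congr 1
      ext w
      simpa using fun h : τ w ≤ τ z => h.trans hz
    simp only [e1, e2]
    ring
  have hlin : Integrable (fun z => a * β z + b * α z) (μ.restrict {z | τ z ≤ s}) :=
    (hβ.const_mul a).add (hα.const_mul b)
  have hmain : Integrable (fun z =>
      (∫ w in {w | τ w < τ z}, α w ∂(μ.restrict {z | τ z ≤ s})) * β z
          + (∫ w in {w | τ w ≤ τ z}, β w ∂(μ.restrict {z | τ z ≤ s})) * α z)
      (μ.restrict {z | τ z ≤ s}) := by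
    set ν := μ.restrict {z | τ z ≤ s}
    have bd : ∀ (γ : S → ℝ) (A : Set S), Integrable γ ν →
        ‖∫ w in A, γ w ∂ν‖ ≤ ∫ w, ‖γ w‖ ∂ν := fun γ A hγ =>
      (norm_integral_le_integral_norm _).trans
        (setIntegral_le_integral hγ.norm (Eventually.of_forall fun _ => norm_nonneg _))
    refine Integrable.add (hβ.bdd_mul (c := ∫ w, ‖α w‖ ∂ν) ?_
      (Eventually.of_forall fun z => bd α _ hα)) (hα.bdd_mul (c := ∫ w, ‖β w‖ ∂ν) ?_
      (Eventually.of_forall fun z => bd β _ hβ))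
    · have h := (hα.1.comp_snd (μ := ν)).indicator
        (measurableSet_lt (hτ.comp measurable_snd) (hτ.comp measurable_fst) :
          MeasurableSet {p : S × S | τ p.2 < τ p.1})
      refine h.integral_prod_right'.congr (Eventually.of_forall fun z => ?_)
      change _ = ∫ w in {w | τ w < τ z}, α w ∂ν
      rw [← integral_indicator (measurableSet_lt hτ measurable_const)]
      rfl
    · have h := (hβ.1.comp_snd (μ := ν)).indicator
        (measurableSet_le (hτ.comp measurable_snd) (hτ.comp measurable_fst) :
          MeasurableSet {p : S × S | τ p.2 ≤ τ p.1})
      refine h.integral_prod_right'.congr (Eventually.of_forall fun z => ?_)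
      change _ = ∫ w in {w | τ w ≤ τ z}, β w ∂ν
      rw [← integral_indicator (measurableSet_le hτ measurable_const)]
      rfl
  refine ⟨?_, (hmain.add hlin).congr ((ae_restrict_iff' hms).2
    (Eventually.of_forall fun z hz => (hI hz).symm))⟩
  rw [setIntegral_congr_fun hms hI, integral_add hmain hlin, ← key,
    integral_add (hβ.const_mul a) (hα.const_mul b), integral_const_mul, integral_const_mul]
  ring

end ByParts

/-! ### Iterated integrals over increasing times -/

section Simplex

variable {S : Type*} [MeasurableSpace S]

/-- The `n`-fold integral of the product measure `m^n` over `t < τ z₁ < ⋯ < τ zₙ`. -/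
def simplexMass (τ : S → ℝ≥0) (m : Measure S) : ℕ → ℝ≥0 → ℝ≥0∞
  | 0, _ => 1
  | n + 1, t => ∫⁻ z in {z | t < τ z}, simplexMass τ m n (τ z) ∂m

variable {τ : S → ℝ≥0} {m : Measure S}

theorem simplexMass_antitone (n : ℕ) : Antitone (simplexMass τ m n) := by
  cases n with
  | zero => exact fun _ _ _ => le_rfl
  | succ n => exact fun s t hst => lintegral_mono_set fun z (hz : t < τ z) => hst.trans_lt hz

theorem measurable_simplexMass (n : ℕ) : Measurable (simplexMass τ m n) :=
  (simplexMass_antitone n).measurable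

/-- One step of the bound `mⁿ / n!`, which for a measure with atoms holds as an inequality because
the simplices are open: a chain of `n` strictly increasing times together with one free time
contains `n + 1` disjoint copies of the next simplex, one for each place of the free time. -/
theorem succ_mul_simplexMass_succ_le [SFinite m] (hτ : Measurable τ) (n : ℕ) (t : ℝ≥0) :
    (n + 1 : ℝ≥0∞) * simplexMass τ m (n + 1) t ≤ m {z | t < τ z} * simplexMass τ m n t := by
  induction n generalizing t with
  | zero => simp [simplexMass]
  | succ n ih =>
    have hI : Measurable fun z => simplexMass τ m n (τ z) := (measurable_simplexMass n).comp hτ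
    have hlt : ∀ u : ℝ≥0, MeasurableSet {z | u < τ z} := fun u =>
      measurableSet_lt measurable_const hτ
    have hF : Measurable fun z => m {w | τ z < τ w} :=
      ((show Antitone fun u : ℝ≥0 => m {w | u < τ w} from
        fun s u hsu => measure_mono fun z (hz : u < τ z) => hsu.trans_lt hz).measurable).comp hτ
    -- The square is split along the diagonal, whose mass is discarded.
    have hsq : (∫⁻ z in {z | t < τ z}, m {w | τ z < τ w} * simplexMass τ m n (τ z) ∂m)
          + simplexMass τ m (n + 2) t
        ≤ m {z | t < τ z} * simplexMass τ m (n + 1) t := by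
      have h1 : Measurable fun p : S × S => τ p.1 := hτ.comp measurable_fst
      have h2 : Measurable fun p : S × S => τ p.2 := hτ.comp measurable_snd
      have g1 : MeasurableSet {p : S × S | t < τ p.1} := measurableSet_lt measurable_const h1
      have g2 : MeasurableSet {p : S × S | t < τ p.2} := measurableSet_lt measurable_const h2
      have g12 : MeasurableSet {p : S × S | τ p.1 < τ p.2} := measurableSet_lt h1 h2
      have g21 : MeasurableSet {p : S × S | τ p.2 < τ p.1} := measurableSet_lt h2 h1
      have hA : MeasurableSet {p : S × S | t < τ p.1 ∧ τ p.1 < τ p.2} := g1.inter g12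
      have hB : MeasurableSet {p : S × S | t < τ p.2 ∧ τ p.2 < τ p.1} := g2.inter g21
      have hC : MeasurableSet {p : S × S | t < τ p.1 ∧ t < τ p.2} := g1.inter g2
      have hf : Measurable fun p : S × S => simplexMass τ m n (τ p.1) := hI.comp measurable_fst
      have e1 : (∫⁻ z in {z | t < τ z}, m {w | τ z < τ w} * simplexMass τ m n (τ z) ∂m)
          = ∫⁻ p, {p : S × S | t < τ p.1 ∧ τ p.1 < τ p.2}.indicator
              (fun p => simplexMass τ m n (τ p.1)) p ∂(m.prod m) := by
        rw [lintegral_prod _ (hf.indicator hA).aemeasurable, ← lintegral_indicator (hlt t)]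
        congr 1 with z
        by_cases hz : t < τ z
        · simp only [Set.indicator, Set.mem_ofPred_eq, hz, true_and, if_true]
          rw [mul_comm, ← setLIntegral_const, ← lintegral_indicator (hlt (τ z))]
          rfl
        · simp [Set.indicator, hz]
      have e2 : simplexMass τ m (n + 2) t
          = ∫⁻ p, {p : S × S | t < τ p.2 ∧ τ p.2 < τ p.1}.indicator
              (fun p => simplexMass τ m n (τ p.1)) p ∂(m.prod m) := by
        rw [lintegral_prod_symm _ (hf.indicator hB).aemeasurable, simplexMass,
          ← lintegral_indicator (hlt t)]
        congr 1 with z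
        by_cases hz : t < τ z
        · simp only [Set.indicator, Set.mem_ofPred_eq, hz, true_and, if_true]
          rw [simplexMass, ← lintegral_indicator (hlt (τ z))]
          rfl
        · simp [Set.indicator, hz]
      rw [e1, e2, ← lintegral_add_left (hf.indicator hA), simplexMass, mul_comm,
        ← setLIntegral_const, ← lintegral_indicator (hlt t)]
      have e3 : ∀ w, {z | t < τ z}.indicator
          (fun _ => ∫⁻ z in {z | t < τ z}, simplexMass τ m n (τ z) ∂m) w
          = ∫⁻ z, {p : S × S | t < τ p.1 ∧ t < τ p.2}.indicator
              (fun p => simplexMass τ m n (τ p.1)) (z, w) ∂m := by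
        intro w
        by_cases hw : t < τ w
        · simp only [Set.indicator, Set.mem_ofPred_eq, hw, and_true, if_true]
          rw [← lintegral_indicator (hlt t)]
          rfl
        · simp [Set.indicator, hw]
      simp only [e3]
      rw [← lintegral_prod_symm _ (hf.indicator hC).aemeasurable]
      refine lintegral_mono fun p => ?_
      by_cases h1 : τ p.1 < τ p.2
      · by_cases h2 : t < τ p.1
        · simp [Set.indicator, h1, h2, h1.not_gt, h2.trans h1]
        · simp [Set.indicator, h1.le, h2]
      · by_cases h2 : τ p.2 < τ p.1
        · by_cases h3 : t < τ p.2
          · simp [Set.indicator, h1, h2, h3, h3.trans h2]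
          · simp [Set.indicator, h1, h3]
        · simp [Set.indicator, h1, h2]
    refine le_trans ?_ hsq
    push_cast
    rw [add_mul, one_mul]
    gcongr
    rw [simplexMass, ← lintegral_const_mul (n + 1 : ℝ≥0∞)
      (f := fun z => simplexMass τ m (n + 1) (τ z)) ((measurable_simplexMass (n + 1)).comp hτ)]
    exact lintegral_mono fun z => ih (τ z)

theorem factorial_mul_simplexMass_le [SFinite m] (hτ : Measurable τ) (n : ℕ) (t : ℝ≥0) :
    (n ! : ℝ≥0∞) * simplexMass τ m n t ≤ m Set.univ ^ n := by
  induction n with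
  | zero => simp [simplexMass]
  | succ n ih =>
    calc ((n + 1)! : ℝ≥0∞) * simplexMass τ m (n + 1) t
        = (n ! : ℝ≥0∞) * ((n + 1 : ℝ≥0∞) * simplexMass τ m (n + 1) t) := by
          rw [Nat.factorial_succ]; push_cast; ring
      _ ≤ (n ! : ℝ≥0∞) * (m {z | t < τ z} * simplexMass τ m n t) := by
          exact mul_le_mul_right (succ_mul_simplexMass_succ_le hτ n t) _
      _ ≤ m Set.univ * ((n ! : ℝ≥0∞) * simplexMass τ m n t) := by
          rw [mul_left_comm]; gcongr; exact Set.subset_univ _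
      _ ≤ m Set.univ ^ (n + 1) := by
          rw [pow_succ']; gcongr

theorem toReal_simplexMass_le [IsFiniteMeasure m] (hτ : Measurable τ) (n : ℕ) (t : ℝ≥0) :
    simplexMass τ m n t ≠ ∞ ∧
      (simplexMass τ m n t).toReal ≤ (m Set.univ).toReal ^ n / (n ! : ℝ) := by
  have h := factorial_mul_simplexMass_le (m := m) hτ n t
  have hn : (n ! : ℝ≥0∞) ≠ 0 := by exact_mod_cast n.factorial_ne_zero
  have hfin : m Set.univ ^ n ≠ ∞ := ENNReal.pow_ne_top (measure_ne_top _ _)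
  have h1 : simplexMass τ m n t ≤ m Set.univ ^ n / (n ! : ℝ≥0∞) := by
    rwa [ENNReal.le_div_iff_mul_le (Or.inl hn) (Or.inl (ENNReal.natCast_ne_top _)), mul_comm]
  have h2 : m Set.univ ^ n / (n ! : ℝ≥0∞) ≠ ∞ := ENNReal.div_ne_top hfin hn
  refine ⟨ne_top_of_le_ne_top h2 h1, ?_⟩
  have := ENNReal.toReal_mono h2 h1
  simpa [ENNReal.toReal_div, ENNReal.toReal_pow] using this

end Simplex

/-! ### Linear Volterra equations with a measure that may have atoms -/

section Volterra

variable {S P ι : Type*} [MeasurableSpace S] [MeasurableSpace P] [Fintype ι]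

theorem norm_mulVec_le_sum_norm_mul (M : Matrix ι ι ℝ) (x : ι → ℝ) :
    ‖M *ᵥ x‖ ≤ (∑ i, ∑ j, ‖M i j‖) * ‖x‖ := by
  refine (pi_norm_le_iff_of_nonneg (by positivity)).2 fun i => ?_
  calc ‖(M *ᵥ x) i‖ ≤ ∑ j, ‖M i j * x j‖ := norm_sum_le _ _
    _ ≤ ∑ j, ‖M i j‖ * ‖x‖ := Finset.sum_le_sum fun j _ => by
        rw [norm_mul]; gcongr; exact norm_le_pi_norm x j
    _ = (∑ j, ‖M i j‖) * ‖x‖ := by rw [Finset.sum_mul]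
    _ ≤ _ := by
        refine mul_le_mul_of_nonneg_right ?_ (norm_nonneg _)
        exact Finset.single_le_sum (f := fun i => ∑ j, ‖M i j‖)
          (fun _ _ => by positivity) (Finset.mem_univ i)

theorem measurable_mulVec {X : Type*} [MeasurableSpace X] {M : X → Matrix ι ι ℝ} {w : X → ι → ℝ}
    (hM : ∀ i j, Measurable fun x => M x i j) (hw : Measurable w) :
    Measurable fun x => M x *ᵥ w x := by
  refine measurable_pi_lambda _ fun i => ?_
  exact Finset.measurable_fun_sum _ fun j _ => (hM i j).mul ((measurable_pi_apply j).comp hw)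

theorem integrable_mulVec {μ : Measure S} {M : S → Matrix ι ι ℝ} {w : S → ι → ℝ} {C : ℝ}
    (hM : ∀ i j, Integrable (fun x => M x i j) μ) (hw : AEStronglyMeasurable w μ)
    (hC : ∀ x, ‖w x‖ ≤ C) : Integrable (fun x => M x *ᵥ w x) μ := by
  refine Integrable.of_eval fun i => ?_
  refine integrable_finsetSum _ fun j _ => ?_
  refine (hM i j).mul_bdd (c := C)
    ((continuous_apply j).comp_aestronglyMeasurable hw) (Eventually.of_forall fun x => ?_)
  exact (norm_le_pi_norm _ j).trans (hC x)

/-- The terms of the Picard series of the backward equation `v_t = 𝟏 + ∫_{t < τ} K v_τ dκ`. -/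
def picardTerm (τ : S → ℝ≥0) (κ : Kernel P S) (K : P → S → Matrix ι ι ℝ) :
    ℕ → ℝ≥0 → P → ι → ℝ
  | 0, _, _ => 1
  | n + 1, t, p => ∫ z in {z | t < τ z}, K p z *ᵥ picardTerm τ κ K n (τ z) p ∂κ p

variable {τ : S → ℝ≥0} {κ : Kernel P S} {K : P → S → Matrix ι ι ℝ}

theorem measurable_picardTerm [IsSFiniteKernel κ] (hτ : Measurable τ)
    (hK : ∀ i j, Measurable fun q : P × S => K q.1 q.2 i j) (n : ℕ) :
    Measurable fun q : ℝ≥0 × P => picardTerm τ κ K n q.1 q.2 := by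
  induction n with
  | zero => exact measurable_const
  | succ n ih =>
    have hset : MeasurableSet {q : (ℝ≥0 × P) × S | q.1.1 < τ q.2} :=
      measurableSet_lt measurable_fst.fst (hτ.comp measurable_snd)
    have hf : Measurable fun q : (ℝ≥0 × P) × S =>
        K q.1.2 q.2 *ᵥ picardTerm τ κ K n (τ q.2) q.1.2 := by
      refine measurable_mulVec (fun i j => (hK i j).comp
        (measurable_fst.snd.prodMk measurable_snd)) ?_
      exact ih.comp ((hτ.comp measurable_snd).prodMk measurable_fst.snd)
    have h := (hf.indicator hset).stronglyMeasurable.integral_kernel_prod_right'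
      (κ := κ.comap Prod.snd measurable_snd)
    convert h.measurable using 2 with q
    simp only [Kernel.comap_apply, picardTerm]
    rw [← integral_indicator (measurableSet_lt measurable_const hτ)]
    rfl

/-- The mass of the matrix-valued measure `K dκ`, with the sum of the absolute values of the
entries as norm. -/
def entryMeasure (κ : Kernel P S) (K : P → S → Matrix ι ι ℝ) (p : P) : Measure S :=
  (κ p).withDensity fun z => ‖∑ i, ∑ j, ‖K p z i j‖‖ₑ

theorem isFiniteMeasure_entryMeasure {p : P} (hint : ∀ i j, Integrable (fun z => K p z i j) (κ p)) :
    IsFiniteMeasure (entryMeasure κ K p) := by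
  refine isFiniteMeasure_withDensity ?_
  have : Integrable (fun z => ∑ i, ∑ j, ‖K p z i j‖) (κ p) :=
    integrable_finsetSum _ fun i _ => integrable_finsetSum _ fun j _ => (hint i j).norm
  exact this.2.ne

theorem enorm_picardTerm_le [IsSFiniteKernel κ] (hτ : Measurable τ)
    (hK : ∀ i j, Measurable fun q : P × S => K q.1 q.2 i j) (n : ℕ) (t : ℝ≥0) (p : P) :
    ‖picardTerm τ κ K n t p‖ₑ ≤ simplexMass τ (entryMeasure κ K p) n t := by
  have hk : Measurable fun z => ‖∑ i, ∑ j, ‖K p z i j‖‖ₑ := by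
    refine Measurable.enorm (Finset.measurable_fun_sum _ fun i _ =>
      Finset.measurable_fun_sum _ fun j _ => ?_)
    exact ((hK i j).comp measurable_prodMk_left).norm
  induction n generalizing t with
  | zero =>
    simp only [picardTerm, simplexMass, ← ofReal_norm]
    rw [ENNReal.ofReal_le_one]
    exact (pi_norm_le_iff_of_nonneg zero_le_one).2 fun i => by simp
  | succ n ih =>
    have e := setLIntegral_withDensity_eq_setLIntegral_mul (κ p) hk
      (g := fun z => simplexMass τ (entryMeasure κ K p) n (τ z))
      ((measurable_simplexMass n).comp hτ)
      (measurableSet_lt (measurable_const (a := t)) hτ)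
    rw [picardTerm]
    refine le_trans ?_ e.ge
    refine (enorm_integral_le_lintegral_enorm _).trans (lintegral_mono fun z => ?_)
    calc ‖K p z *ᵥ picardTerm τ κ K n (τ z) p‖ₑ
        ≤ ‖(∑ i, ∑ j, ‖K p z i j‖) * ‖picardTerm τ κ K n (τ z) p‖‖ₑ := by
          rw [enorm_le_iff_norm_le]
          exact (norm_mulVec_le_sum_norm_mul _ _).trans (Real.le_norm_self _)
      _ ≤ _ := by
          rw [enorm_mul, enorm_norm]
          exact mul_le_mul_right (ih (τ z)) _

/-- The backward Volterra equation `v_t = 𝟏 + ∫_{t < τ} K v_τ dκ` has a bounded solution, which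
depends measurably on time and on the parameter. Only times later than `t` enter, so that atoms of
`κ` do no harm. -/
theorem exists_backward_volterra [IsSFiniteKernel κ] (hτ : Measurable τ)
    (hK : ∀ i j, Measurable fun q : P × S => K q.1 q.2 i j)
    (hint : ∀ p i j, Integrable (fun z => K p z i j) (κ p)) :
    ∃ v : ℝ≥0 → P → ι → ℝ, (Measurable fun q : ℝ≥0 × P => v q.1 q.2) ∧
      (∀ p, ∃ C, ∀ t, ‖v t p‖ ≤ C) ∧
      ∀ t p, v t p = 1 + ∫ z in {z | t < τ z}, K p z *ᵥ v (τ z) p ∂κ p := by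
  set c : P → ℝ := fun p => (entryMeasure κ K p Set.univ).toReal
  have hc : ∀ p, 0 ≤ c p := fun p => ENNReal.toReal_nonneg
  have hbd : ∀ n t p, ‖picardTerm τ κ K n t p‖ ≤ c p ^ n / (n ! : ℝ) := by
    intro n t p
    have := isFiniteMeasure_entryMeasure (hint p)
    obtain ⟨h1, h2⟩ := toReal_simplexMass_le (m := entryMeasure κ K p) hτ n t
    refine le_trans ?_ h2
    rw [← toReal_enorm]
    exact ENNReal.toReal_mono h1 (enorm_picardTerm_le hτ hK n t p)
  have hsummable : ∀ t p, Summable fun n => picardTerm τ κ K n t p := fun t p =>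
    Summable.of_norm_bounded (Real.summable_pow_div_factorial (c p)) fun n => hbd n t p
  refine ⟨fun t p => ∑' n, picardTerm τ κ K n t p, ?_, fun p => ⟨∑' n, c p ^ n / (n ! : ℝ), ?_⟩, ?_⟩
  · refine measurable_of_tendsto_metrizable (f := fun n (q : ℝ≥0 × P) =>
      ∑ k ∈ Finset.range n, picardTerm τ κ K k q.1 q.2) (fun n =>
        Finset.measurable_fun_sum _ fun k _ => measurable_picardTerm hτ hK k) ?_
    exact tendsto_pi_nhds.2 fun q => (hsummable q.1 q.2).hasSum.tendsto_sum_nat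
  · intro t
    exact tsum_of_norm_bounded (Real.summable_pow_div_factorial (c p)).hasSum fun n => hbd n t p
  · intro t p
    have hmeas : ∀ n, Measurable fun z => picardTerm τ κ K n (τ z) p := fun n =>
      (measurable_picardTerm hτ hK n).comp (hτ.prodMk measurable_const)
    have hInt : ∀ n, Integrable (fun z => K p z *ᵥ picardTerm τ κ K n (τ z) p)
        ((κ p).restrict {z | t < τ z}) := fun n =>
      (integrable_mulVec (hint p) (hmeas n).aestronglyMeasurable fun z => hbd n (τ z) p).restrict
    have hkint : Integrable (fun z => ∑ i, ∑ j, ‖K p z i j‖) ((κ p).restrict {z | t < τ z}) :=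
      (integrable_finsetSum _ fun i _ => integrable_finsetSum _ fun j _ =>
        (hint p i j).norm).restrict
    have hsum : Summable fun n =>
        ∫ z in {z | t < τ z}, ‖K p z *ᵥ picardTerm τ κ K n (τ z) p‖ ∂κ p := by
      refine Summable.of_nonneg_of_le (fun n => integral_nonneg fun z => norm_nonneg _)
        (f := fun n => (∫ z in {z | t < τ z}, ∑ i, ∑ j, ‖K p z i j‖ ∂κ p) * (c p ^ n / (n ! : ℝ)))
        (fun n => ?_) ((Real.summable_pow_div_factorial (c p)).mul_left _)
      rw [← integral_mul_const]
      refine integral_mono (hInt n).norm (hkint.mul_const _) fun z => ?_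
      refine (norm_mulVec_le_sum_norm_mul _ _).trans ?_
      gcongr
      exact hbd n _ p
    beta_reduce
    rw [(hsummable t p).tsum_eq_zero_add, show picardTerm τ κ K 0 t p = 1 from rfl]
    congr 1
    change ∑' n, ∫ z in {z | t < τ z}, K p z *ᵥ picardTerm τ κ K n (τ z) p ∂κ p = _
    rw [integral_tsum_of_summable_integral_norm hInt hsum]
    congr 1 with z : 1
    exact ((hsummable (τ z) p).hasSum.mapL
      (LinearMap.toContinuousLinearMap (Matrix.mulVecLin (K p z)))).tsum_eq

end Volterra

/-! ### Lebesgue measure on the half line -/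

/-- Lebesgue measure on `ℝ≥0`. -/
def nnLebesgue : Measure ℝ≥0 := Measure.comap ((↑) : ℝ≥0 → ℝ) volume

theorem measurableEmbedding_nnrealCoe : MeasurableEmbedding ((↑) : ℝ≥0 → ℝ) :=
  MeasurableEmbedding.subtype_coe measurableSet_Ici

theorem map_coe_nnLebesgue_restrict (t : ℝ≥0) :
    (nnLebesgue.restrict (Set.Ioc 0 t)).map ((↑) : ℝ≥0 → ℝ)
      = (volume : Measure ℝ).restrict (Set.Ioc 0 t) := by
  have h := measurableEmbedding_nnrealCoe.restrict_map nnLebesgue (Set.Ioc (0 : ℝ) t)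
  have hpre : ((↑) : ℝ≥0 → ℝ) ⁻¹' Set.Ioc (0 : ℝ) t = Set.Ioc 0 t := by
    ext u
    simp
  rw [hpre] at h
  rw [← h, nnLebesgue, measurableEmbedding_nnrealCoe.map_comap,
    Measure.restrict_restrict measurableSet_Ioc]
  congr 1
  ext u
  simp only [Set.mem_inter_iff, Set.mem_Ioc, Set.mem_range, and_iff_left_iff_imp]
  exact fun hu => ⟨⟨u, hu.1.le⟩, rfl⟩

theorem intervalIntegral_toNNReal {E : Type*} [NormedAddCommGroup E] [NormedSpace ℝ E]
    (f : ℝ≥0 → E) (t : ℝ≥0) :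
    ∫ u in (0 : ℝ)..t, f u.toNNReal = ∫ u in Set.Ioc 0 t, f u ∂nnLebesgue := by
  rw [intervalIntegral.integral_of_le t.coe_nonneg, ← map_coe_nnLebesgue_restrict,
    measurableEmbedding_nnrealCoe.integral_map]
  simp

theorem intervalIntegrable_toNNReal_iff {E : Type*} [NormedAddCommGroup E]
    (f : ℝ≥0 → E) (t : ℝ≥0) :
    IntervalIntegrable (fun u : ℝ => f u.toNNReal) volume 0 t
      ↔ IntegrableOn f (Set.Ioc 0 t) nnLebesgue := by
  rw [intervalIntegrable_iff_integrableOn_Ioc_of_le t.coe_nonneg, IntegrableOn,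
    ← map_coe_nnLebesgue_restrict, measurableEmbedding_nnrealCoe.integrable_map_iff, IntegrableOn]
  simp [comp_def]

instance : NullSingletonClass nnLebesgue := by
  refine ⟨fun x => ?_⟩
  rw [nnLebesgue, measurableEmbedding_nnrealCoe.comap_apply]
  simp

theorem nnLebesgue_Ioc_zero (t : ℝ≥0) : nnLebesgue (Set.Ioc 0 t) = t := by
  rw [nnLebesgue, measurableEmbedding_nnrealCoe.comap_apply]
  have : ((↑) : ℝ≥0 → ℝ) '' Set.Ioc 0 t = Set.Ioc (0 : ℝ) t := by
    ext u
    constructor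
    · rintro ⟨v, hv, rfl⟩
      simpa using hv
    · exact fun hu => ⟨⟨u, hu.1.le⟩, ⟨hu.1, hu.2⟩, rfl⟩
  rw [this, Real.volume_Ioc]
  simp

instance (t : ℝ≥0) : IsFiniteMeasure (nnLebesgue.restrict (Set.Ioc 0 t)) :=
  ⟨by rw [Measure.restrict_apply_univ, nnLebesgue_Ioc_zero]; exact ENNReal.coe_lt_top⟩

instance : SFinite nnLebesgue := by
  have : SigmaFinite nnLebesgue := by
    refine ⟨⟨⟨fun n => Set.Iic (n : ℝ≥0), fun _ => trivial, fun n => ?_, ?_⟩⟩⟩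
    · have h : Set.Iic (n : ℝ≥0) = {0} ∪ Set.Ioc 0 (n : ℝ≥0) := by
        ext u
        rcases eq_or_ne u 0 with rfl | hu
        · simp
        · simp
      rw [h]
      refine (measure_union_le _ _).trans_lt ?_
      rw [measure_singleton, zero_add, nnLebesgue_Ioc_zero]
      exact ENNReal.coe_lt_top
    · refine Set.eq_univ_of_forall fun u => Set.mem_iUnion.2 ?_
      exact exists_nat_ge u
  infer_instance

/-! ### Piecewise constant paths with left limits -/

section StatePath

variable {N : ℕ}

theorem nhdsLT_zero_eq_bot : 𝓝[<] (0 : ℝ≥0) = ⊥ := by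
  rw [show Set.Iio (0 : ℝ≥0) = ∅ from Set.Iio_eq_empty_iff.2 isMin_bot, nhdsWithin_empty]

theorem nnreal_nhdsLT_neBot {t : ℝ≥0} (ht : 0 < t) : (𝓝[<] t).NeBot :=
  nhdsLT_neBot_of_exists_lt ⟨0, ht⟩

theorem eventually_eq_leftLim {x : ℝ≥0 → Fin N} {t : ℝ≥0}
    (h : ∃ i, ∀ᶠ s in 𝓝[<] t, x s = i) : ∀ᶠ s in 𝓝[<] t, x s = leftLim x t := by
  rcases eq_or_ne t 0 with rfl | ht
  · rw [nhdsLT_zero_eq_bot]; trivial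
  · have := nnreal_nhdsLT_neBot (pos_iff_ne_zero.2 ht)
    obtain ⟨i, hi⟩ := h
    have hlim : Tendsto x (𝓝[<] t) (𝓝 i) :=
      tendsto_const_nhds.congr' (hi.mono fun s hs => hs.symm)
    rw [leftLim_eq_of_tendsto hlim]
    exact hi

/-- Grid points of mesh `1 / (n + 1)` strictly before `u` (if `u ≠ 0`). -/
def leftGrid (n k : ℕ) : ℝ≥0 := (k - 1 : ℕ) / (n + 1)

theorem leftGrid_ceil_lt (n : ℕ) {u : ℝ≥0} (hu : 0 < u) : leftGrid n ⌈(n + 1) * u⌉₊ < u := by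
  have hpos : 0 < ⌈(n + 1) * u⌉₊ := Nat.ceil_pos.2 (by positivity)
  have h := Nat.ceil_lt_add_one (R := ℝ≥0) (a := (n + 1) * u) (by positivity)
  rw [leftGrid, div_lt_iff₀ (by positivity), mul_comm u]
  obtain ⟨k, hk⟩ := Nat.exists_eq_succ_of_ne_zero hpos.ne'
  rw [hk] at h ⊢
  simpa using h

theorem tendsto_leftGrid_ceil (u : ℝ≥0) :
    Tendsto (fun n : ℕ => leftGrid n ⌈(n + 1) * u⌉₊) atTop (𝓝 u) := by
  rw [← NNReal.tendsto_coe]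
  have h0 : Tendsto (fun n : ℕ => (u : ℝ) - 1 / ((n : ℝ) + 1)) atTop (𝓝 u) := by
    simpa using tendsto_const_nhds.sub (tendsto_one_div_add_atTop_nhds_zero_nat (𝕜 := ℝ))
  refine tendsto_of_tendsto_of_tendsto_of_le_of_le h0 tendsto_const_nhds (fun n => ?_) fun n => ?_
  · have h := Nat.le_ceil ((n + 1 : ℝ≥0) * u)
    have h1 : ((n + 1 : ℝ≥0) * u : ℝ≥0) ≤ ((⌈(n + 1) * u⌉₊ - 1 : ℕ) : ℝ≥0) + 1 := by
      refine h.trans ?_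
      exact_mod_cast (by omega : ⌈(n + 1) * u⌉₊ ≤ (⌈(n + 1) * u⌉₊ - 1) + 1)
    have h2 : ((n : ℝ) + 1) * u ≤ ((⌈(n + 1) * u⌉₊ - 1 : ℕ) : ℝ) + 1 := by exact_mod_cast h1
    have hn : (0 : ℝ) < n + 1 := by positivity
    simp only [leftGrid, NNReal.coe_div, NNReal.coe_add, NNReal.coe_natCast, NNReal.coe_one]
    rw [sub_le_iff_le_add, ← add_div, le_div_iff₀ hn]
    linarith
  · rcases eq_or_ne u 0 with rfl | hu
    · simp [leftGrid]
    · exact_mod_cast (leftGrid_ceil_lt n (pos_iff_ne_zero.2 hu)).le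

/-- The left limits of a process that is measurable at each time are jointly measurable. -/
theorem measurable_leftLim_uncurry {Ω : Type*} [MeasurableSpace Ω] {X : ℝ≥0 → Ω → Fin N}
    (hX : ∀ t, Measurable (X t)) (hl : ∀ ω t, ∃ i, ∀ᶠ s in 𝓝[<] t, X s ω = i) :
    Measurable fun q : ℝ≥0 × Ω => leftLim (fun s => X s q.2) q.1 := by
  refine measurable_of_tendsto_metrizable
    (f := fun n (q : ℝ≥0 × Ω) => X (leftGrid n ⌈(n + 1) * q.1⌉₊) q.2) (fun n => ?_) ?_
  · have h1 : Measurable fun q : ℕ × Ω => X (leftGrid n q.1) q.2 :=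
      measurable_from_prod_countable_right fun k => hX (leftGrid n k)
    have h2 : Measurable fun q : ℝ≥0 × Ω => (⌈((n : ℝ≥0) + 1) * q.1⌉₊, q.2) :=
      (Nat.measurable_ceil.comp (measurable_fst.const_mul _)).prodMk measurable_snd
    have h3 := h1.comp h2
    rw [comp_def] at h3
    exact h3
  · refine tendsto_pi_nhds.2 fun ⟨u, ω⟩ => ?_
    rcases eq_or_ne u 0 with rfl | hu
    · simp [leftGrid, leftLim_eq_of_eq_bot _ nhdsLT_zero_eq_bot]
    · have h1 : Tendsto (fun n : ℕ => leftGrid n ⌈(n + 1) * u⌉₊) atTop (𝓝[<] u) :=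
        tendsto_nhdsWithin_iff.2 ⟨tendsto_leftGrid_ceil u,
          Eventually.of_forall fun n => leftGrid_ceil_lt n (pos_iff_ne_zero.2 hu)⟩
      exact tendsto_const_nhds.congr'
        ((h1.eventually (eventually_eq_leftLim (hl ω u))).mono fun n hn => hn.symm)

theorem leftLim_comp_min {x : ℝ≥0 → Fin N} (hl : ∀ t, ∃ i, ∀ᶠ s in 𝓝[<] t, x s = i)
    {u t : ℝ≥0} (hut : u ≤ t) : leftLim (fun s => x (min s t)) u = leftLim x u := by
  rcases eq_or_ne u 0 with rfl | hu
  · simp [leftLim_eq_of_eq_bot _ nhdsLT_zero_eq_bot]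
  · have := nnreal_nhdsLT_neBot (pos_iff_ne_zero.2 hu)
    refine leftLim_eq_of_tendsto (tendsto_const_nhds.congr' ?_)
    filter_upwards [eventually_eq_leftLim (hl u), self_mem_nhdsWithin] with s hs (hsu : s < u)
    rw [min_eq_left (hsu.le.trans hut), hs]

end StatePath

/-! ### Counting paths -/

namespace CountingPath

theorem mem_jumps {y : CountingPath} {t u : ℝ≥0} :
    u ∈ y.jumps t ↔ 0 < u ∧ u ≤ t ∧ leftLim y u ≠ y u := by
  simp [jumps]

theorem filter_jumps (y : CountingPath) {s t : ℝ≥0} (hst : s ≤ t) :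
    (y.jumps t).filter (· ≤ s) = y.jumps s := by
  ext u
  simp only [Finset.mem_filter, mem_jumps]
  exact ⟨fun h => ⟨h.1.1, h.2, h.1.2.2⟩, fun h => ⟨⟨h.1, h.2.1.trans hst, h.2.2⟩, h.2.1⟩⟩

theorem eventually_eq_leftLim (y : CountingPath) {u : ℝ≥0} :
    ∀ᶠ s in 𝓝[<] u, y s = leftLim y u := by
  have h := y.monotone.tendsto_leftLim u
  simpa using h

/-- As the jumps have size one, their number up to time `t` is the increment of the path. This is
how the jump times depend measurably on the values of the path. -/
theorem card_jumps (y : CountingPath) (t : ℝ≥0) : (y.jumps t).card = y t - y 0 := by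
  rw [← Nat.card_Ioc]
  refine Finset.card_bij (fun u _ => y u) ?_ ?_ ?_
  · intro u hu
    obtain ⟨h0, ht, hne⟩ := mem_jumps.1 hu
    have h1 : y 0 ≤ leftLim y u := y.monotone.le_leftLim h0
    have h2 : leftLim y u ≤ y u := y.monotone.leftLim_le le_rfl
    exact Finset.mem_Ioc.2 ⟨h1.trans_lt (lt_of_le_of_ne h2 hne), y.monotone ht⟩
  · intro s hs u hu hsu
    by_contra hne
    wlog hlt : s < u generalizing s u
    · exact this u hu s hs hsu.symm (Ne.symm hne) (lt_of_le_of_ne (not_lt.1 hlt) (Ne.symm hne))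
    have h1 : y s ≤ leftLim y u := y.monotone.le_leftLim hlt
    have h2 : leftLim y u ≤ y u := y.monotone.leftLim_le le_rfl
    exact (mem_jumps.1 hu).2.2 (by omega)
  · intro k hk
    obtain ⟨hk0, hkt⟩ := Finset.mem_Ioc.1 hk
    -- The jump to level `k` takes place at the first time the path reaches `k`.
    set u := sInf {s : ℝ≥0 | k ≤ y s} with hu
    have hne : {s : ℝ≥0 | k ≤ y s}.Nonempty := ⟨t, hkt⟩
    have hku : k ≤ y u := by
      by_contra hlt
      obtain ⟨v, huv, hv⟩ := mem_nhdsGT_iff_exists_Ioo_subset.1 (y.right_constant u)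
      obtain ⟨s, hs, hsv⟩ := exists_lt_of_csInf_lt hne (show sInf {s : ℝ≥0 | k ≤ y s} < v from huv)
      have hus : u ≤ s := csInf_le (OrderBot.bddBelow _) hs
      rcases hus.eq_or_lt with rfl | hlt'
      · exact hlt hs
      · have : y s = y u := hv ⟨hlt', hsv⟩
        exact hlt (this ▸ hs)
    have hbefore : ∀ s < u, y s < k := fun s hs =>
      not_le.1 fun h => (notMem_of_lt_csInf hs (OrderBot.bddBelow _)) h
    have hupos : 0 < u := by
      refine pos_iff_ne_zero.2 fun h => ?_
      rw [h] at hku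
      omega
    have := nnreal_nhdsLT_neBot hupos
    obtain ⟨s, hs, hsu⟩ := ((y.eventually_eq_leftLim (u := u)).and self_mem_nhdsWithin).exists
    have h1 := hbefore s hsu
    have h2 := y.jump_le_one u
    refine ⟨u, mem_jumps.2 ⟨hupos, csInf_le (OrderBot.bddBelow _) hkt, ?_⟩, ?_⟩ <;> omega

/-- The space-time measure that drives the backward equation on `]0,T]`: Lebesgue measure, with the
mark `false`, and the jumps of `y`, with the mark `true`. -/
def drivingMeasure (T : ℝ≥0) (y : CountingPath) : Measure (ℝ≥0 × Bool) :=
  (nnLebesgue.restrict (Set.Ioc 0 T)).map (fun u => (u, false))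
    + ∑ u ∈ y.jumps T, Measure.dirac (u, true)

variable {T : ℝ≥0} {y : CountingPath}

instance : IsFiniteMeasure (y.drivingMeasure T) := by
  rw [drivingMeasure]; infer_instance

theorem ae_drivingMeasure_of {p : ℝ≥0 × Bool → Prop}
    (h₁ : ∀ᵐ u ∂nnLebesgue.restrict (Set.Ioc 0 T), p (u, false))
    (h₂ : ∀ u ∈ y.jumps T, p (u, true)) : ∀ᵐ z ∂y.drivingMeasure T, p z := by
  have hemb : MeasurableEmbedding fun u : ℝ≥0 => (u, false) := measurableEmbedding_prod_mk_right _
  rw [drivingMeasure, ae_add_measure_iff, hemb.ae_map_iff]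
  refine ⟨h₁, ae_finsetSum_measure_iff.2 fun u hu => ?_⟩
  rw [ae_dirac_eq]
  exact h₂ u hu

theorem ae_drivingMeasure (y : CountingPath) (T : ℝ≥0) :
    ∀ᵐ z ∂y.drivingMeasure T, 0 < z.1 ∧ z.1 ≤ T :=
  ae_drivingMeasure_of (ae_restrict_mem measurableSet_Ioc) fun _ hu =>
    ⟨(mem_jumps.1 hu).1, (mem_jumps.1 hu).2.1⟩

theorem ae_drivingMeasure_ne {u : ℝ≥0} (hu : u ∉ y.jumps T) :
    ∀ᵐ z ∂y.drivingMeasure T, z.1 ≠ u :=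
  ae_drivingMeasure_of (ae_restrict_of_ae (compl_mem_ae_iff.2 (measure_singleton u)))
    fun _ hw h => hu (h ▸ hw)

section Integrals

variable {E : Type*} [NormedAddCommGroup E]

theorem integrable_drivingMeasure_iff {f : ℝ≥0 × Bool → E} :
    Integrable f (y.drivingMeasure T)
      ↔ IntegrableOn (fun u => f (u, false)) (Set.Ioc 0 T) nnLebesgue := by
  have hemb : MeasurableEmbedding fun u : ℝ≥0 => (u, false) := measurableEmbedding_prod_mk_right _
  rw [drivingMeasure, integrable_add_measure, hemb.integrable_map_iff, and_iff_left]
  · rfl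
  · rw [integrable_finsetSum_measure]
    exact fun u _ => integrable_dirac (by simp)

theorem integral_drivingMeasure [NormedSpace ℝ E] [CompleteSpace E] {f : ℝ≥0 × Bool → E}
    (hf : IntegrableOn (fun u => f (u, false)) (Set.Ioc 0 T) nnLebesgue) :
    ∫ z, f z ∂y.drivingMeasure T
      = (∫ u in Set.Ioc 0 T, f (u, false) ∂nnLebesgue) + ∑ u ∈ y.jumps T, f (u, true) := by
  have hemb : MeasurableEmbedding fun u : ℝ≥0 => (u, false) := measurableEmbedding_prod_mk_right _
  have h : Integrable f (y.drivingMeasure T) := integrable_drivingMeasure_iff.2 hf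
  rw [drivingMeasure] at h ⊢
  rw [integral_add_measure (integrable_add_measure.1 h).1 (integrable_add_measure.1 h).2,
    hemb.integral_map, integral_finsetSum_measure fun u _ => integrable_dirac (by simp)]
  simp

theorem setIntegral_drivingMeasure [NormedSpace ℝ E] [CompleteSpace E] {f : ℝ≥0 × Bool → E}
    (hf : IntegrableOn (fun u => f (u, false)) (Set.Ioc 0 T) nnLebesgue)
    (B : Set ℝ≥0) [DecidablePred (· ∈ B)] (hB : MeasurableSet B) :
    ∫ z in {z | z.1 ∈ B}, f z ∂y.drivingMeasure T
      = (∫ u in Set.Ioc 0 T ∩ B, f (u, false) ∂nnLebesgue)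
        + ∑ u ∈ (y.jumps T).filter (· ∈ B), f (u, true) := by
  have hB' : MeasurableSet {z : ℝ≥0 × Bool | z.1 ∈ B} := measurable_fst hB
  rw [← integral_indicator hB', integral_drivingMeasure]
  · congr 1
    · rw [Set.inter_comm, ← Measure.restrict_restrict hB, ← integral_indicator hB]
      rfl
    · rw [Finset.sum_filter]
      refine Finset.sum_congr rfl fun u _ => ?_
      simp [Set.indicator]
  · exact hf.integrable.indicator hB

theorem setIntegral_drivingMeasure_le [NormedSpace ℝ E] [CompleteSpace E] {f : ℝ≥0 × Bool → E}
    (hf : IntegrableOn (fun u => f (u, false)) (Set.Ioc 0 T) nnLebesgue) {s : ℝ≥0} (hs : s ≤ T) :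
    ∫ z in {z | z.1 ≤ s}, f z ∂y.drivingMeasure T
      = (∫ u in Set.Ioc 0 s, f (u, false) ∂nnLebesgue) + ∑ u ∈ y.jumps s, f (u, true) := by
  have h := setIntegral_drivingMeasure (y := y) hf (Set.Iic s) measurableSet_Iic
  simp only [Set.mem_Iic, filter_jumps y hs, Set.Ioc_inter_Iic, min_eq_right hs] at h
  exact h

theorem setIntegral_drivingMeasure_lt [NormedSpace ℝ E] [CompleteSpace E] {f : ℝ≥0 × Bool → E}
    (hf : IntegrableOn (fun u => f (u, false)) (Set.Ioc 0 T) nnLebesgue) {s : ℝ≥0} (hs : s ≤ T) :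
    ∫ z in {z | z.1 < s}, f z ∂y.drivingMeasure T
      = (∫ u in Set.Ioc 0 s, f (u, false) ∂nnLebesgue)
        + ∑ u ∈ (y.jumps s).filter (· < s), f (u, true) := by
  have h := setIntegral_drivingMeasure (y := y) hf (Set.Iio s) measurableSet_Iio
  have hset : (Set.Ioc 0 T ∩ Set.Iio s : Set ℝ≥0) =ᵐ[nnLebesgue] (Set.Ioc 0 s : Set ℝ≥0) := by
    have hIoo : Set.Ioc 0 T ∩ Set.Iio s = Set.Ioo 0 s := by
      ext u
      exact ⟨fun h => ⟨h.1.1, h.2⟩, fun h => ⟨⟨h.1, h.2.le.trans hs⟩, h.2⟩⟩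
    rw [hIoo]
    exact Ioo_ae_eq_Ioc
  have hfilter : (y.jumps T).filter (· < s) = (y.jumps s).filter (· < s) := by
    rw [← filter_jumps y hs, Finset.filter_filter]
    exact Finset.filter_congr fun u _ => ⟨fun h => ⟨h.le, h⟩, fun h => h.2⟩
  rw [setIntegral_congr_set hset] at h
  simp only [Set.mem_Iio, hfilter] at h
  exact h

end Integrals

section Kernel

variable {P : Type*} [MeasurableSpace P] {Y : P → CountingPath}

theorem measurable_drivingMeasure (hY : ∀ s ≤ T, Measurable fun p => Y p s) :
    Measurable fun p => (Y p).drivingMeasure T := by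
  have hcard : ∀ s ≤ T, Measurable fun p => (((Y p).jumps s).card : ℝ≥0∞) := by
    intro s hs
    simp only [card_jumps]
    exact (measurable_from_top (f := fun n : ℕ => (n : ℝ≥0∞))).comp
      ((hY s hs).sub (hY 0 zero_le))
  have hsum : Measurable fun p => ∑ u ∈ (Y p).jumps T, Measure.dirac u := by
    refine Measurable.measure_of_isPiSystem (borel_eq_generateFrom_Iic ℝ≥0 ▸ NNReal.borelSpace.1)
      isPiSystem_Iic ?_ ?_
    · rintro _ ⟨a, rfl⟩
      have : ∀ p, (∑ u ∈ (Y p).jumps T, Measure.dirac u) (Set.Iic a)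
          = (((Y p).jumps (min a T)).card : ℝ≥0∞) := by
        intro p
        rw [← filter_jumps (Y p) (min_le_right a T), Finset.card_filter, Measure.finsetSum_apply]
        push_cast
        refine Finset.sum_congr rfl fun u hu => ?_
        rw [Measure.dirac_apply' _ measurableSet_Iic]
        simp [Set.indicator, (mem_jumps.1 hu).2.1]
      simp only [this]
      exact hcard _ (min_le_right a T)
    · simpa using hcard T le_rfl
  have hmap : ∀ p, (Y p).drivingMeasure T
      = (nnLebesgue.restrict (Set.Ioc 0 T)).map (fun u => (u, false))
        + (∑ u ∈ (Y p).jumps T, Measure.dirac u).map (fun u => (u, true)) := by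
    intro p
    have hm : Measurable fun u : ℝ≥0 => (u, true) := measurable_id.prodMk measurable_const
    rw [drivingMeasure, ← Measure.mapₗ_apply_of_measurable hm, map_sum]
    simp [Measure.mapₗ_apply_of_measurable hm, Measure.map_dirac' hm]
  refine Measure.measurable_of_measurable_coe _ fun s hs => ?_
  simp only [hmap, Measure.add_apply]
  refine measurable_const.add ?_
  exact (Measure.measurable_coe hs).comp ((Measure.measurable_map _
    (measurable_id.prodMk measurable_const)).comp hsum)

/-- The driving measures of a family of counting paths, as a kernel. -/
def drivingKernel (T : ℝ≥0) (Y : P → CountingPath) (hY : ∀ s ≤ T, Measurable fun p => Y p s) :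
    Kernel P (ℝ≥0 × Bool) where
  toFun p := (Y p).drivingMeasure T
  measurable' := measurable_drivingMeasure hY

end Kernel

end CountingPath

/-- A kernel of finite measures, not necessarily of uniformly bounded mass, is s-finite. -/
theorem isSFiniteKernel_of_isFiniteMeasure {α β : Type*} [MeasurableSpace α] [MeasurableSpace β]
    (κ : Kernel α β) [hκ : ∀ a, IsFiniteMeasure (κ a)] : IsSFiniteKernel κ := by
  have hmeas : Measurable fun a => ⌊(κ a Set.univ).toReal⌋₊ :=
    Nat.measurable_floor.comp (κ.measurable_coe MeasurableSet.univ).ennreal_toReal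
  have hset : ∀ n, MeasurableSet {a | ⌊(κ a Set.univ).toReal⌋₊ = n} := fun n =>
    hmeas (measurableSet_singleton n)
  classical
  refine ⟨fun n => Kernel.piecewise (hset n) κ 0, fun n => ⟨(n + 1 : ℝ≥0∞), by
    exact_mod_cast ENNReal.natCast_lt_top (n + 1), fun a => ?_⟩, ?_⟩
  · rw [Kernel.piecewise_apply]
    split_ifs with h
    · have h1 := (Nat.lt_floor_add_one (κ a Set.univ).toReal).le
      rw [show ⌊(κ a Set.univ).toReal⌋₊ = n from h] at h1
      rw [← ENNReal.toReal_le_toReal (measure_ne_top _ _) (by finiteness)]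
      exact h1.trans_eq (by norm_cast)
    · simp
  · ext a s hs
    rw [Kernel.sum_apply' _ _ hs, tsum_eq_single ⌊(κ a Set.univ).toReal⌋₊]
    · simp [Kernel.piecewise_apply]
    · intro n hn
      rw [Kernel.piecewise_apply, if_neg (fun h => hn h.symm)]
      simp

instance {P : Type*} [MeasurableSpace P] {T : ℝ≥0} {Y : P → CountingPath}
    {hY : ∀ s ≤ T, Measurable fun p => Y p s} :
    IsSFiniteKernel (CountingPath.drivingKernel T Y hY) :=
  have : ∀ p, IsFiniteMeasure (CountingPath.drivingKernel T Y hY p) := fun p =>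
    inferInstanceAs (IsFiniteMeasure ((Y p).drivingMeasure T))
  isSFiniteKernel_of_isFiniteMeasure _

/-! ### The likelihood along a fixed observation path -/

/-- A Lipschitz function of an absolutely continuous function is absolutely continuous. -/
theorem AbsolutelyContinuousOnInterval.lipschitzOnWith_comp {f g : ℝ → ℝ} {a b : ℝ} {s : Set ℝ}
    {C : ℝ≥0} (hf : AbsolutelyContinuousOnInterval f a b) (hg : LipschitzOnWith C g s)
    (hmaps : Set.MapsTo f (Set.uIcc a b) s) : AbsolutelyContinuousOnInterval (g ∘ f) a b := by
  have h0 : Tendsto (fun E : ℕ × (ℕ → ℝ × ℝ) =>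
      (C : ℝ) * ∑ i ∈ Finset.range E.1, dist (f (E.2 i).1) (f (E.2 i).2))
      (AbsolutelyContinuousOnInterval.totalLengthFilter
        ⊓ 𝓟 (AbsolutelyContinuousOnInterval.disjWithin a b)) (𝓝 0) := by
    simpa using Tendsto.const_mul (C : ℝ) hf
  refine squeeze_zero' (Eventually.of_forall fun E =>
    Finset.sum_nonneg fun _ _ => dist_nonneg) ?_ h0
  filter_upwards [mem_inf_of_right (mem_principal_self _)] with E hE
  rw [Finset.mul_sum]
  refine Finset.sum_le_sum fun i hi => ?_
  exact hg.dist_le_mul _ (hmaps (hE.1 i hi).1) _ (hmaps (hE.1 i hi).2)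

/-- The integrand is merely integrable, so the exponential is differentiated almost everywhere and
recovered by absolute continuity. -/
theorem exp_neg_intervalIntegral {f : ℝ → ℝ} {t : ℝ} (hf : IntervalIntegrable f volume 0 t) :
    Real.exp (-∫ u in (0 : ℝ)..t, f u)
      = 1 + ∫ u in (0 : ℝ)..t, -f u * Real.exp (-∫ w in (0 : ℝ)..u, f w) := by
  have hac := (hf.absolutelyContinuousOnInterval_intervalIntegral
    (c := 0) Set.left_mem_uIcc).neg
  set F : ℝ → ℝ := -fun u => ∫ w in (0 : ℝ)..u, f w with hF
  have hcont := hac.continuousOn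
  obtain ⟨R, hR⟩ := (isCompact_uIcc.image_of_continuousOn hcont).isBounded.subset_closedBall 0
  have hlip : ∃ C, LipschitzOnWith C Real.exp (Metric.closedBall (0 : ℝ) R) :=
    (Real.contDiff_exp (n := 1)).contDiffOn.exists_lipschitzOnWith (by decide)
      (convex_closedBall _ _) (isCompact_closedBall _ _)
  obtain ⟨C, hC⟩ := hlip
  have hexp : AbsolutelyContinuousOnInterval (Real.exp ∘ F) 0 t :=
    hac.lipschitzOnWith_comp hC fun x hx => hR (Set.mem_image_of_mem _ hx)
  have h1 := hexp.integral_deriv_eq_sub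
  have h2 : ∫ u in (0 : ℝ)..t, deriv (Real.exp ∘ F) u
      = ∫ u in (0 : ℝ)..t, -f u * Real.exp (-∫ w in (0 : ℝ)..u, f w) := by
    refine intervalIntegral.integral_congr_ae ?_
    filter_upwards [hf.ae_hasDerivAt_integral] with u hu hut
    have h3 := ((hu (Set.uIoc_subset_uIcc hut) 0 Set.left_mem_uIcc).neg).exp
    rw [show (Real.exp ∘ F) = fun x => Real.exp (-(fun u => ∫ w in (0 : ℝ)..u, f w) x) from rfl]
    refine h3.deriv.trans (mul_comm _ _)
  rw [← h2, h1]
  simp [hF]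

/-- The likelihood at time `t` of the counting path `y` when its intensity is `r`. -/
def pathLikelihood (y : CountingPath) (r : ℝ≥0 → ℝ) (t : ℝ≥0) : ℝ :=
  Real.exp (-∫ u in (0 : ℝ)..t, (r u.toNNReal - 1)) * ∏ u ∈ y.jumps t, r u

/-- The left limit at time `u ≤ T` of `pathLikelihood`, written as the likelihood at time `T` for
the intensity that is replaced by `1` from time `u` on. -/
def leftPathLikelihood (y : CountingPath) (r : ℝ≥0 → ℝ) (T u : ℝ≥0) : ℝ :=
  pathLikelihood y (fun w => if w < u then r w else 1) T

/-- The density of the stochastic logarithm of `pathLikelihood` with respect to the driving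
measure. -/
def logRate (r : ℝ≥0 → ℝ) (z : ℝ≥0 × Bool) : ℝ :=
  if z.2 then r z.1 - 1 else 1 - r z.1

section Path

variable {y : CountingPath} {r : ℝ≥0 → ℝ} {T : ℝ≥0}

theorem filter_lt_jumps {u t : ℝ≥0} (hut : u ≤ t) :
    (y.jumps t).filter (· < u) = (y.jumps u).filter (· < u) := by
  ext w
  simp only [Finset.mem_filter, CountingPath.mem_jumps]
  exact ⟨fun h => ⟨⟨h.1.1, h.2.le, h.1.2.2⟩, h.2⟩,
    fun h => ⟨⟨h.1.1, h.2.le.trans hut, h.1.2.2⟩, h.2⟩⟩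

/-- The product over the jumps, written as one plus the sum of its increments. -/
theorem prod_jumps_eq_one_add_sum (t : ℝ≥0) :
    ∏ u ∈ y.jumps t, r u
      = 1 + ∑ u ∈ y.jumps t, (∏ w ∈ (y.jumps u).filter (· < u), r w) * (r u - 1) := by
  have h := Finset.prod_one_add_ordered (y.jumps t) fun u => r u - 1
  simp only [add_sub_cancel] at h
  rw [h]
  congr 1
  refine Finset.sum_congr rfl fun u hu => ?_
  rw [filter_lt_jumps (CountingPath.mem_jumps.1 hu).2.1, mul_comm]

theorem prod_filter_lt_jumps_eq_one_add_sum (t : ℝ≥0) :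
    ∏ u ∈ (y.jumps t).filter (· < t), r u
      = 1 + ∑ u ∈ (y.jumps t).filter (· < t),
          (∏ w ∈ (y.jumps u).filter (· < u), r w) * (r u - 1) := by
  have h := Finset.prod_one_add_ordered ((y.jumps t).filter (· < t)) fun u => r u - 1
  simp only [add_sub_cancel] at h
  rw [h]
  congr 1
  refine Finset.sum_congr rfl fun u hu => ?_
  have hu' := (CountingPath.mem_jumps.1 (Finset.mem_filter.1 hu).1).2.1
  rw [← filter_lt_jumps hu', mul_comm, Finset.filter_filter]
  congr 2
  ext w
  simp only [Finset.mem_filter, and_congr_right_iff, and_iff_right_iff_imp]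
  exact fun _ h => h.trans (Finset.mem_filter.1 hu).2

/-- The left limit of the likelihood at `u`: the factor of a jump at `u` itself is missing. -/
theorem leftPathLikelihood_eq {u : ℝ≥0} (hu : u ≤ T) :
    leftPathLikelihood y r T u = Real.exp (-∫ w in (0 : ℝ)..u, (r w.toNNReal - 1))
      * ∏ w ∈ (y.jumps u).filter (· < u), r w := by
  have h1 : (∫ w in (0 : ℝ)..T, ((if w.toNNReal < u then r w.toNNReal else 1) - 1))
      = ∫ w in (0 : ℝ)..u, (r w.toNNReal - 1) := by
    rw [intervalIntegral_toNNReal (fun w => r w - 1),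
      intervalIntegral_toNNReal (fun w => (if w < u then r w else 1) - 1),
      ← integral_indicator measurableSet_Ioc, ← integral_indicator measurableSet_Ioc]
    refine integral_congr_ae ?_
    filter_upwards [compl_mem_ae_iff.2 (measure_singleton u)] with w (hw : w ≠ u)
    by_cases hwu : w < u
    · have h1 : w ∈ Set.Ioc 0 T ↔ w ∈ Set.Ioc 0 u := by simp [hwu.le, hwu.le.trans hu]
      by_cases h2 : w ∈ Set.Ioc 0 u
      · simp only [Set.indicator_of_mem (h1.2 h2), Set.indicator_of_mem h2, if_pos hwu]
      · simp only [Set.indicator_of_notMem (mt h1.1 h2), Set.indicator_of_notMem h2]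
    · have h2 : w ∉ Set.Ioc 0 u := fun h => hwu (lt_of_le_of_ne h.2 hw)
      rw [Set.indicator_of_notMem h2]
      by_cases h3 : w ∈ Set.Ioc 0 T
      · simp [Set.indicator_of_mem h3, hwu]
      · rw [Set.indicator_of_notMem h3]
  rw [leftPathLikelihood, pathLikelihood, h1, ← filter_lt_jumps hu, Finset.prod_filter]

theorem leftPathLikelihood_eq_of_notMem {u : ℝ≥0} (huT : u ≤ T) (hu : u ∉ y.jumps T) :
    leftPathLikelihood y r T u = pathLikelihood y r u := by
  rw [leftPathLikelihood_eq huT, pathLikelihood, Finset.filter_true_of_mem]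
  intro w hw
  have h := CountingPath.mem_jumps.1 hw
  refine lt_of_le_of_ne h.2.1 ?_
  rintro rfl
  exact hu (CountingPath.mem_jumps.2 ⟨h.1, huT, h.2.2⟩)

theorem pathLikelihood_congr {r' : ℝ≥0 → ℝ} {t : ℝ≥0} (h : ∀ u, 0 < u → u ≤ t → r u = r' u) :
    pathLikelihood y r t = pathLikelihood y r' t := by
  rw [pathLikelihood, pathLikelihood, intervalIntegral_toNNReal (fun u => r u - 1),
    intervalIntegral_toNNReal (fun u => r' u - 1),
    setIntegral_congr_fun measurableSet_Ioc (g := fun u => r' u - 1)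
      (fun u hu => by simp only [h u hu.1 hu.2]),
    Finset.prod_congr rfl fun u hu => h u (CountingPath.mem_jumps.1 hu).1
      (CountingPath.mem_jumps.1 hu).2.1]

theorem pathLikelihood_pos (hpos : ∀ u, 0 < r u) (t : ℝ≥0) : 0 < pathLikelihood y r t :=
  mul_pos (Real.exp_pos _) (Finset.prod_pos fun u _ => hpos u)

/-- Positive rates decrease the exponential factor to at most `e^t`, so a bound for the rates at the
jumps bounds the likelihood. -/
theorem pathLikelihood_le {R : ℝ≥0 → ℝ} {t : ℝ≥0} (hr : IntegrableOn r (Set.Ioc 0 t) nnLebesgue)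
    (hpos : ∀ u, 0 < r u) (hR : ∀ u, r u ≤ R u) :
    pathLikelihood y r t ≤ Real.exp t * ∏ u ∈ y.jumps t, R u := by
  refine mul_le_mul ?_ (Finset.prod_le_prod (fun u _ => (hpos u).le) fun u _ => hR u)
    (Finset.prod_nonneg fun u _ => (hpos u).le) (Real.exp_pos _).le
  rw [Real.exp_le_exp, intervalIntegral_toNNReal (fun u => r u - 1), ← integral_neg]
  have h1 : IntegrableOn (fun _ => (1 : ℝ)) (Set.Ioc 0 t) nnLebesgue := integrable_const _
  calc ∫ u in Set.Ioc 0 t, -(r u - 1) ∂nnLebesgue ≤ ∫ u in Set.Ioc 0 t, (1 : ℝ) ∂nnLebesgue :=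
        integral_mono (hr.sub h1).neg h1 fun u => by
          have := hpos u
          simp only
          linarith
    _ = t := by simp [Measure.real, nnLebesgue_Ioc_zero]

theorem ae_notMem_jumps (y : CountingPath) (T : ℝ≥0) : ∀ᵐ u ∂nnLebesgue, u ∉ y.jumps T :=
  compl_mem_ae_iff.2 (Finset.measure_zero _ _)

/-- The product rule for the likelihood and a function `b` given as an indefinite integral with
respect to the driving measure. -/
theorem pathLikelihood_mul_eq (hr : IntegrableOn r (Set.Ioc 0 T) nnLebesgue)
    {b : ℝ≥0 → ℝ} {β : ℝ≥0 × Bool → ℝ} {b₀ : ℝ}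
    (hβ : IntegrableOn (fun u => β (u, false)) (Set.Ioc 0 T) nnLebesgue)
    (hb : ∀ s ≤ T, b s = b₀ + ∫ z in {z | z.1 ≤ s}, β z ∂y.drivingMeasure T)
    {s : ℝ≥0} (hs : s ≤ T) :
    pathLikelihood y r s * b s = b₀ + ∫ z in {z | z.1 ≤ s},
      leftPathLikelihood y r T z.1 * (β z + logRate r z * b z.1) ∂y.drivingMeasure T := by
  set μ := y.drivingMeasure T with hμ
  set e : ℝ≥0 → ℝ := fun u => Real.exp (-∫ w in (0 : ℝ)..u, (r w.toNNReal - 1)) with he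
  set J : ℝ≥0 → ℝ := fun u => ∏ w ∈ (y.jumps u).filter (· < u), r w with hJ
  have hr1 : IntegrableOn (fun u => r u - 1) (Set.Ioc 0 T) nnLebesgue :=
    hr.sub (integrable_const (1 : ℝ))
  -- The exponential factor is continuous, hence bounded on `[0,T]`.
  have hecont : ContinuousOn e (Set.Iic T) := by
    have h1 : IntegrableOn (fun u : ℝ => r u.toNNReal - 1) (Set.uIcc 0 (T : ℝ)) volume :=
      (intervalIntegrable_iff' (by simp)).1
        ((intervalIntegrable_toNNReal_iff (fun u => r u - 1) T).2 hr1)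
    have h2 := (intervalIntegral.continuousOn_primitive_interval h1)
    refine Real.continuous_exp.comp_continuousOn (ContinuousOn.neg ?_)
    refine h2.comp NNReal.continuous_coe.continuousOn fun u (hu : u ≤ T) => ?_
    rw [Set.uIcc_of_le T.coe_nonneg]
    exact ⟨u.coe_nonneg, hu⟩
  obtain ⟨Ce, hCe⟩ : ∃ C, ∀ u ∈ Set.Ioc 0 T, ‖e u‖ ≤ C := by
    obtain ⟨C, hC⟩ := (isCompact_Icc (a := (0 : ℝ≥0)) (b := T)).exists_bound_of_continuousOn
      (hecont.mono Set.Icc_subset_Iic_self)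
    exact ⟨C, fun u hu => hC u ⟨hu.1.le, hu.2⟩⟩
  have hint : IntegrableOn (fun u => -(r u - 1) * e u) (Set.Ioc 0 T) nnLebesgue :=
    hr1.neg.mul_bdd (c := Ce)
      ((hecont.mono fun u hu => hu.2).aestronglyMeasurable measurableSet_Ioc)
      ((ae_restrict_iff' measurableSet_Ioc).2 (Eventually.of_forall hCe))
  set α : ℝ≥0 × Bool → ℝ := fun z => if z.2 then J z.1 * (r z.1 - 1) else 0 with hα
  set γ : ℝ≥0 × Bool → ℝ := fun z => if z.2 then 0 else -(r z.1 - 1) * e z.1 with hγ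
  have hαint : IntegrableOn (fun u => α (u, false)) (Set.Ioc 0 T) nnLebesgue := by
    simp [hα]
  have hγint : IntegrableOn (fun u => γ (u, false)) (Set.Ioc 0 T) nnLebesgue := by
    simpa [hγ] using hint
  have hexp : ∀ u ≤ T, e u = 1 + ∫ w in Set.Ioc 0 u, γ (w, false) ∂nnLebesgue := by
    intro u hu
    have h1 := exp_neg_intervalIntegral ((intervalIntegrable_toNNReal_iff (fun u => r u - 1) u).2
      (hr1.mono_set (Set.Ioc_subset_Ioc_right hu)))
    rw [he]
    beta_reduce
    rw [h1, ← intervalIntegral_toNNReal]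
    congr 1
    refine intervalIntegral.integral_congr fun w hw => ?_
    rw [Set.uIcc_of_le u.coe_nonneg] at hw
    simp [hγ, he, Real.coe_toNNReal w hw.1]
  have hE : ∀ u ≤ T, e u = 1 + ∫ z in {z | z.1 ≤ u}, γ z ∂μ := by
    intro u hu
    rw [hμ, CountingPath.setIntegral_drivingMeasure_le hγint hu, ← add_assoc, ← hexp u hu]
    simp [hγ]
  have hE' : ∀ u ≤ T, e u = 1 + ∫ z in {z | z.1 < u}, γ z ∂μ := by
    intro u hu
    rw [hμ, CountingPath.setIntegral_drivingMeasure_lt hγint hu, ← add_assoc, ← hexp u hu]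
    simp [hγ]
  have hJle : ∀ u ≤ T, ∏ w ∈ y.jumps u, r w = 1 + ∫ z in {z | z.1 ≤ u}, α z ∂μ := by
    intro u hu
    rw [hμ, CountingPath.setIntegral_drivingMeasure_le hαint hu, prod_jumps_eq_one_add_sum]
    simp [hα, hJ]
  have hJlt : ∀ u ≤ T, J u = 1 + ∫ z in {z | z.1 < u}, α z ∂μ := by
    intro u hu
    rw [hμ, CountingPath.setIntegral_drivingMeasure_lt hαint hu, hJ]
    beta_reduce
    rw [prod_filter_lt_jumps_eq_one_add_sum]
    simp [hα, hJ]
  have hαμ : Integrable α μ := CountingPath.integrable_drivingMeasure_iff.2 hαint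
  have hβμ : Integrable β μ := CountingPath.integrable_drivingMeasure_iff.2 hβ
  have hγμ : Integrable γ μ := CountingPath.integrable_drivingMeasure_iff.2 hγint
  have hmle : ∀ u : ℝ≥0, MeasurableSet {z : ℝ≥0 × Bool | z.1 ≤ u} := fun u =>
    measurableSet_le measurable_fst measurable_const
  have hcongr1 : ∀ u ≤ T, Set.EqOn (fun z => (1 + ∫ w in {w | w.1 < z.1}, γ w ∂μ) * β z
        + (b₀ + ∫ w in {w | w.1 ≤ z.1}, β w ∂μ) * γ z)
      (fun z => e z.1 * β z + b z.1 * γ z) {z | z.1 ≤ u} := by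
    intro u hu z (hz : z.1 ≤ u)
    simp only [← hE' z.1 (hz.trans hu), ← hb z.1 (hz.trans hu)]
  have heb : ∀ u ≤ T, e u * b u
      = b₀ + ∫ z in {z | z.1 ≤ u}, (e z.1 * β z + b z.1 * γ z) ∂μ := by
    intro u hu
    have h := (add_integral_mul_add_integral measurable_fst u 1 b₀ hγμ.integrableOn
      hβμ.integrableOn).1
    rw [← hE u hu, ← hb u hu, one_mul, setIntegral_congr_fun (hmle u) (hcongr1 u hu)] at h
    exact h
  have hebint : IntegrableOn (fun z => e z.1 * β z + b z.1 * γ z) {z | z.1 ≤ s} μ := by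
    have h := (add_integral_mul_add_integral measurable_fst s 1 b₀ hγμ.integrableOn
      hβμ.integrableOn).2
    exact h.congr_fun (hcongr1 s hs) (hmle s)
  have h := (add_integral_mul_add_integral measurable_fst s 1 b₀ hαμ.integrableOn hebint).1
  rw [← hJle s hs, ← heb s hs, one_mul] at h
  rw [pathLikelihood, mul_comm (Real.exp _), mul_assoc, h]
  congr 1
  refine setIntegral_congr_fun (hmle s) fun z (hz : z.1 ≤ s) => ?_
  simp only [← hJlt z.1 (hz.trans hs), ← heb z.1 (hz.trans hs),
    leftPathLikelihood_eq (hz.trans hs)]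
  obtain ⟨u, m⟩ := z
  cases m <;> simp only [hα, hγ, logRate, he, hJ, Bool.false_eq_true,
    if_false, if_true] <;> ring

/-- The likelihood depends measurably on the observation path and on the intensity. -/
theorem measurable_pathLikelihood {P : Type*} [MeasurableSpace P] {Y : P → CountingPath} {t : ℝ≥0}
    (hY : ∀ s ≤ t, Measurable fun p => Y p s) {r : P → ℝ≥0 → ℝ}
    (hr : Measurable fun q : P × ℝ≥0 => r q.1 q.2) (hpos : ∀ p u, 0 < r p u) :
    Measurable fun p => pathLikelihood (Y p) (r p) t := by
  have h1 : Measurable fun p => ∫ u in Set.Ioc 0 t, (r p u - 1) ∂nnLebesgue :=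
    (hr.sub_const 1).stronglyMeasurable.integral_prod_right.measurable
  have hlog : Measurable fun q : P × (ℝ≥0 × Bool) =>
      if q.2.2 then Real.log (r q.1 q.2.1) else 0 := by
    refine Measurable.ite ?_ (hr.comp (measurable_fst.prodMk measurable_snd.fst)).log
      measurable_const
    exact measurable_snd.snd (measurableSet_singleton true)
  have h2 := (hlog.stronglyMeasurable.integral_kernel_prod_right'
    (κ := CountingPath.drivingKernel t Y hY)).measurable
  have h3 : ∀ p, pathLikelihood (Y p) (r p) t
      = Real.exp (-∫ u in Set.Ioc 0 t, (r p u - 1) ∂nnLebesgue)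
        * Real.exp (∫ z, (if z.2 then Real.log (r p z.1) else 0)
            ∂CountingPath.drivingKernel t Y hY p) := by
    intro p
    have h4 : ∫ z, (if z.2 then Real.log (r p z.1) else 0) ∂CountingPath.drivingKernel t Y hY p
        = ∑ u ∈ (Y p).jumps t, Real.log (r p u) := by
      refine (CountingPath.integral_drivingMeasure (y := Y p) (T := t)
        (f := fun z => if z.2 then Real.log (r p z.1) else 0) ?_).trans ?_
      · simp
      · simp
    rw [pathLikelihood, intervalIntegral_toNNReal (fun u => r p u - 1), h4, Real.exp_sum]
    congr 1
    exact Finset.prod_congr rfl fun u _ => (Real.exp_log (hpos p u)).symm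
  simp only [h3]
  exact h1.neg.exp.mul h2.exp

end Path

/-! ### The martingale problem of the state process -/

section Chain

variable {N : ℕ}

theorem stateVec_apply (i j : Fin N) : stateVec i j = if j = i then (1 : ℝ) else 0 := by
  simp [stateVec, Pi.single_apply]

theorem norm_stateVec_apply_le (i j : Fin N) : ‖stateVec i j‖ ≤ 1 := by
  rw [stateVec_apply]
  split_ifs <;> simp

theorem norm_stateVec_le (i : Fin N) : ‖stateVec i‖ ≤ 1 :=
  (pi_norm_le_iff_of_nonneg zero_le_one).2 fun j => norm_stateVec_apply_le i j

theorem sum_mul_stateVec (f : Fin N → ℝ) (i : Fin N) : ∑ j, f j * stateVec i j = f i := by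
  simp [stateVec_apply]

/-- A right-continuous process that is measurable at each time is jointly measurable. -/
theorem measurable_uncurry_of_right_constant {Ω : Type*} [MeasurableSpace Ω]
    {X : ℝ≥0 → Ω → Fin N} (hX : ∀ t, Measurable (X t))
    (hr : ∀ ω t, ∀ᶠ s in 𝓝[>] t, X s ω = X t ω) :
    Measurable fun q : ℝ≥0 × Ω => X q.1 q.2 := by
  refine measurable_of_tendsto_metrizable
    (f := fun n (q : ℝ≥0 × Ω) => X ((⌊(n + 1) * q.1⌋₊ + 1 : ℕ) / (n + 1)) q.2) (fun n => ?_) ?_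
  · have h1 : Measurable fun q : ℕ × Ω => X ((q.1 + 1 : ℕ) / (n + 1)) q.2 :=
      measurable_from_prod_countable_right fun k => hX ((k + 1 : ℕ) / (n + 1))
    have h2 : Measurable fun q : ℝ≥0 × Ω => (⌊((n : ℝ≥0) + 1) * q.1⌋₊, q.2) :=
      (Nat.measurable_floor.comp (measurable_fst.const_mul _)).prodMk measurable_snd
    have h3 := h1.comp h2
    rw [comp_def] at h3
    exact h3
  · refine tendsto_pi_nhds.2 fun ⟨u, ω⟩ => ?_
    have hlim : Tendsto (fun n : ℕ => ((⌊(n + 1) * u⌋₊ + 1 : ℕ) / (n + 1) : ℝ≥0)) atTop (𝓝 u) := by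
      rw [← NNReal.tendsto_coe]
      have h0 : Tendsto (fun n : ℕ => (u : ℝ) + 1 / ((n : ℝ) + 1)) atTop (𝓝 u) := by
        simpa using tendsto_const_nhds.add (tendsto_one_div_add_atTop_nhds_zero_nat (𝕜 := ℝ))
      refine tendsto_of_tendsto_of_tendsto_of_le_of_le tendsto_const_nhds h0 (fun n => ?_)
        fun n => ?_
      · have h := (Nat.lt_floor_add_one ((n + 1 : ℝ≥0) * u)).le
        have h2 : ((n : ℝ) + 1) * u ≤ (⌊(n + 1) * u⌋₊ : ℝ) + 1 := by exact_mod_cast h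
        have hn : (0 : ℝ) < n + 1 := by positivity
        simp only [NNReal.coe_div, NNReal.coe_add, NNReal.coe_natCast, NNReal.coe_one]
        rw [le_div_iff₀ hn]
        push_cast
        linarith
      · have h := Nat.floor_le (a := (n + 1 : ℝ≥0) * u) (by positivity)
        have h2 : (⌊(n + 1) * u⌋₊ : ℝ) ≤ ((n : ℝ) + 1) * u := by exact_mod_cast h
        have hn : (0 : ℝ) < n + 1 := by positivity
        simp only [NNReal.coe_div, NNReal.coe_add, NNReal.coe_natCast, NNReal.coe_one]
        rw [← sub_le_iff_le_add, ← sub_div, div_le_iff₀ hn]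
        push_cast
        linarith
    have hgt : ∀ n : ℕ, u < ((⌊(n + 1) * u⌋₊ + 1 : ℕ) / (n + 1) : ℝ≥0) := by
      intro n
      rw [lt_div_iff₀ (by positivity), mul_comm u]
      exact_mod_cast Nat.lt_floor_add_one ((n + 1 : ℝ≥0) * u)
    have h1 : Tendsto (fun n : ℕ => ((⌊(n + 1) * u⌋₊ + 1 : ℕ) / (n + 1) : ℝ≥0)) atTop (𝓝[>] u) :=
      tendsto_nhdsWithin_iff.2 ⟨hlim, Eventually.of_forall hgt⟩
    exact tendsto_const_nhds.congr' ((h1.eventually (hr ω u)).mono fun n hn => hn.symm)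

variable {Ω : Type*} [mΩ : MeasurableSpace Ω] {Q : Measure Ω} [IsProbabilityMeasure Q]
  {A : ℝ≥0 → Matrix (Fin N) (Fin N) ℝ} {X : ℝ≥0 → Ω → Fin N} {hXm : ∀ t, Measurable (X t)}

theorem IsRateMatrix.integrableOn (hA : IsRateMatrix A) (t : ℝ≥0) (i j : Fin N) :
    IntegrableOn (fun u => A u i j) (Set.Ioc 0 t) nnLebesgue :=
  (intervalIntegrable_toNNReal_iff (fun u => A u i j) t).1 (hA.integrable i j t)

theorem measurable_stateVec_apply (j : Fin N) : Measurable fun i : Fin N => stateVec i j :=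
  measurable_of_finite _

/-- The martingale problem tested against a bounded variable `ξ` that is known at time `u`. -/
theorem IsMarkovChain.integral_mul_stateVec (hA : IsRateMatrix A) (hX : IsMarkovChain Q A X hXm)
    {u s : ℝ≥0} (hus : u ≤ s) {ξ : Ω → ℝ} (hξ : Measurable[stateFiltration X hXm u] ξ) {C : ℝ}
    (hC : ∀ ω, ‖ξ ω‖ ≤ C) (j : Fin N) :
    ∫ ω, ξ ω * stateVec (X s ω) j ∂Q = ∫ ω, ξ ω * stateVec (X u ω) j ∂Q
      + ∫ r in Set.Ioc u s, ∑ i, A r j i * ∫ ω, ξ ω * stateVec (X r ω) i ∂Q ∂nnLebesgue := by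
  have hle := (stateFiltration X hXm).le u
  have hξ' : Measurable ξ := hξ.mono hle le_rfl
  have hXj := measurable_uncurry_of_right_constant hXm hX.right_constant
  set M : ℝ≥0 → Ω → Fin N → ℝ := fun t ω => stateVec (X t ω) - stateVec (X 0 ω)
      - ∫ u in (0 : ℝ)..t, A u.toNNReal *ᵥ stateVec (X u.toNNReal ω) with hM
  have hMint : ∀ t, Integrable (M t) Q := fun t => hX.martingale.integrable t
  have hξM : ∀ t, Integrable (fun ω => ξ ω • M t ω) Q := fun t =>
    (hMint t).bdd_smul C hξ'.aestronglyMeasurable (Eventually.of_forall hC)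
  have h1 : ∫ ω, ξ ω • M s ω ∂Q = ∫ ω, ξ ω • M u ω ∂Q := by
    rw [← integral_condExp hle (f := fun ω => ξ ω • M s ω)]
    refine integral_congr_ae ?_
    refine (condExp_smul_of_aestronglyMeasurable_left hξ.stronglyMeasurable.aestronglyMeasurable
      (hξM s) (hMint s)).trans ?_
    filter_upwards [hX.martingale.condExp_ae_eq hus] with ω hω
    exact congrArg (ξ ω • ·) hω
  have hAint : ∀ t ω i, IntegrableOn (fun r => (A r *ᵥ stateVec (X r ω)) i) (Set.Ioc 0 t)
      nnLebesgue := by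
    intro t ω i
    refine (Integrable.eval (integrable_mulVec (C := 1) (hA.integrableOn t) ?_
      fun r => norm_stateVec_le _) i)
    exact (Measurable.comp (g := stateVec) (measurable_of_finite _)
      (hXj.comp measurable_prodMk_right)).aestronglyMeasurable
  have hAsum : ∀ t ω, IntegrableOn (fun r => ∑ i, A r j i * stateVec (X r ω) i) (Set.Ioc 0 t)
      nnLebesgue := fun t ω => hAint t ω j
  have hMj : ∀ t ω, M t ω j = stateVec (X t ω) j - stateVec (X 0 ω) j
      - ∫ r in Set.Ioc 0 t, ∑ i, A r j i * stateVec (X r ω) i ∂nnLebesgue := by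
    intro t ω
    simp only [hM, Pi.sub_apply]
    rw [intervalIntegral_toNNReal (fun r => A r *ᵥ stateVec (X r ω)), eval_integral (hAint t ω)]
    rfl
  have hdiff : ∀ ω, M s ω j - M u ω j = stateVec (X s ω) j - stateVec (X u ω) j
      - ∫ r in Set.Ioc u s, ∑ i, A r j i * stateVec (X r ω) i ∂nnLebesgue := by
    intro ω
    rw [hMj, hMj, ← Set.Ioc_union_Ioc_eq_Ioc (zero_le (a := u)) hus,
      setIntegral_union (Set.Ioc_disjoint_Ioc_of_le le_rfl) measurableSet_Ioc
        (hAsum u ω) ((hAsum s ω).mono_set (Set.Ioc_subset_Ioc_left zero_le))]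
    ring
  have hξS : ∀ t i, Integrable (fun ω => ξ ω * stateVec (X t ω) i) Q := fun t i =>
    Integrable.of_bound (hξ'.mul ((measurable_stateVec_apply i).comp (hXm t))).aestronglyMeasurable
      (C := C) (Eventually.of_forall fun ω => by
        rw [norm_mul]
        exact (mul_le_of_le_one_right (norm_nonneg _) (norm_stateVec_apply_le _ _)).trans (hC ω))
  have hFub : ∀ i, Integrable (fun q : ℝ≥0 × Ω => A q.1 j i * (ξ q.2 * stateVec (X q.1 q.2) i))
      ((nnLebesgue.restrict (Set.Ioc u s)).prod Q) := by
    intro i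
    have h3 : Integrable (fun q : ℝ≥0 × Ω => A q.1 j i)
        ((nnLebesgue.restrict (Set.Ioc u s)).prod Q) :=
      Integrable.comp_fst ((hA.integrableOn s j i).mono_set (Set.Ioc_subset_Ioc_left zero_le)) Q
    refine h3.mul_bdd (c := C) ((hξ'.comp measurable_snd).mul
      ((measurable_stateVec_apply i).comp hXj)).aestronglyMeasurable
      (Eventually.of_forall fun q => ?_)
    rw [norm_mul]
    exact (mul_le_of_le_one_right (norm_nonneg _) (norm_stateVec_apply_le _ _)).trans (hC q.2)
  have hFubs := integrable_finsetSum Finset.univ fun i _ => hFub i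
  have hswap : ∫ r in Set.Ioc u s, ∑ i, A r j i * ∫ ω, ξ ω * stateVec (X r ω) i ∂Q ∂nnLebesgue
      = ∫ ω, ξ ω * ∫ r in Set.Ioc u s, ∑ i, A r j i * stateVec (X r ω) i ∂nnLebesgue ∂Q := by
    have h4 := integral_integral_swap (f := fun (r : ℝ≥0) (ω : Ω) =>
      ∑ i, A r j i * (ξ ω * stateVec (X r ω) i)) hFubs
    have h5 : ∀ r, ∫ ω, ∑ i, A r j i * (ξ ω * stateVec (X r ω) i) ∂Q
        = ∑ i, A r j i * ∫ ω, ξ ω * stateVec (X r ω) i ∂Q := by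
      intro r
      rw [integral_finsetSum _ fun i _ => (hξS r i).const_mul _]
      simp only [integral_const_mul]
    have h6 : ∀ ω, ∫ r in Set.Ioc u s, ∑ i, A r j i * (ξ ω * stateVec (X r ω) i) ∂nnLebesgue
        = ξ ω * ∫ r in Set.Ioc u s, ∑ i, A r j i * stateVec (X r ω) i ∂nnLebesgue := by
      intro ω
      rw [← integral_const_mul]
      congr 1 with r
      rw [Finset.mul_sum]
      exact Finset.sum_congr rfl fun i _ => by ring
    simp only [h5, h6] at h4
    exact h4
  have hcoord : ∀ t, ∫ ω, ξ ω * M t ω j ∂Q = (∫ ω, ξ ω • M t ω ∂Q) j := by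
    intro t
    rw [eval_integral fun i => Integrable.eval (hξM t) i]
    rfl
  have hξMj : ∀ t, Integrable (fun ω => ξ ω * M t ω j) Q := fun t => Integrable.eval (hξM t) j
  have hzero : ∫ ω, (ξ ω * stateVec (X s ω) j - ξ ω * stateVec (X u ω) j
      - ξ ω * ∫ r in Set.Ioc u s, ∑ i, A r j i * stateVec (X r ω) i ∂nnLebesgue) ∂Q = 0 := by
    have h7 : ∀ ω, ξ ω * stateVec (X s ω) j - ξ ω * stateVec (X u ω) j
      - ξ ω * ∫ r in Set.Ioc u s, ∑ i, A r j i * stateVec (X r ω) i ∂nnLebesgue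
        = ξ ω * M s ω j - ξ ω * M u ω j := by
      intro ω
      linear_combination -ξ ω * hdiff ω
    simp only [h7]
    rw [integral_sub (hξMj s) (hξMj u), hcoord, hcoord, h1, sub_self]
  have hint3 : Integrable (fun ω =>
      ξ ω * ∫ r in Set.Ioc u s, ∑ i, A r j i * stateVec (X r ω) i ∂nnLebesgue) Q := by
    refine (((hξS s j).sub (hξS u j)).sub ((hξMj s).sub (hξMj u))).congr
      (Eventually.of_forall fun ω => ?_)
    simp only [Pi.sub_apply]
    linear_combination -ξ ω * hdiff ω
  rw [integral_sub (f := fun ω => ξ ω * stateVec (X s ω) j - ξ ω * stateVec (X u ω) j)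
    ((hξS s j).sub (hξS u j)) hint3, integral_sub (hξS s j) (hξS u j)] at hzero
  rw [hswap]
  linarith

theorem measurable_stateFiltration {u t : ℝ≥0} (hut : u ≤ t) :
    Measurable[stateFiltration X hXm t] (X u) :=
  ((Filtration.stronglyAdapted_natural fun t => (hXm t).stronglyMeasurable) u).measurable.mono
    ((stateFiltration X hXm).mono hut) le_rfl

/-- The chain does not jump at a fixed time: its compensator is continuous. -/
theorem IsMarkovChain.leftLim_ae_eq (hA : IsRateMatrix A) (hX : IsMarkovChain Q A X hXm)
    {u : ℝ≥0} (hu : 0 < u) : ∀ᵐ ω ∂Q, leftLim (fun s => X s ω) u = X u ω := by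
  set s : ℕ → ℝ≥0 := fun n => leftGrid n ⌈(n + 1) * u⌉₊ with hs
  have hsu : ∀ n, s n < u := fun n => leftGrid_ceil_lt n hu
  have hslim : Tendsto s atTop (𝓝[<] u) :=
    tendsto_nhdsWithin_iff.2 ⟨tendsto_leftGrid_ceil u, Eventually.of_forall hsu⟩
  have hleft : Measurable fun ω => leftLim (fun s => X s ω) u :=
    (measurable_leftLim_uncurry hXm hX.left_limit).comp measurable_prodMk_left
  have key : ∀ i j, i ≠ j →
      ∫ ω, stateVec (leftLim (fun s => X s ω) u) i * stateVec (X u ω) j ∂Q = 0 := by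
    intro i j hij
    set G : ℝ≥0 → ℝ := fun r => ∑ k, ‖A r j k‖ with hG
    have hGint : IntegrableOn G (Set.Ioc 0 u) nnLebesgue :=
      integrable_finsetSum _ fun k _ => (hA.integrableOn u j k).norm
    have hbound : ∀ n, ‖∫ ω, stateVec (X (s n) ω) i * stateVec (X u ω) j ∂Q‖
        ≤ ∫ r, (Set.Ioc (s n) u).indicator G r ∂nnLebesgue := by
      intro n
      have h := hX.integral_mul_stateVec hA (hsu n).le (ξ := fun ω => stateVec (X (s n) ω) i)
        ((measurable_stateVec_apply i).comp (measurable_stateFiltration le_rfl)) (C := 1)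
        (fun ω => norm_stateVec_apply_le _ _) j
      have h0 : ∀ ω, stateVec (X (s n) ω) i * stateVec (X (s n) ω) j = 0 := by
        intro ω
        simp only [stateVec_apply]
        split_ifs with h1 h2
        · exact absurd (h1.trans h2.symm) hij
        all_goals simp
      simp only [h0, integral_zero, zero_add] at h
      rw [h, integral_indicator measurableSet_Ioc]
      refine norm_integral_le_of_norm_le (hGint.mono_set (Set.Ioc_subset_Ioc_left zero_le))
        (Eventually.of_forall fun r => ?_)
      refine (norm_sum_le _ _).trans (Finset.sum_le_sum fun k _ => ?_)
      rw [norm_mul]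
      refine mul_le_of_le_one_right (norm_nonneg _) ?_
      refine (norm_integral_le_of_norm_le_const (C := 1) (Eventually.of_forall fun ω => ?_)).trans
        (by simp)
      rw [norm_mul]
      exact mul_le_one₀ (norm_stateVec_apply_le _ _) (norm_nonneg _) (norm_stateVec_apply_le _ _)
    have hlim0 : Tendsto (fun n => ∫ r, (Set.Ioc (s n) u).indicator G r ∂nnLebesgue) atTop
        (𝓝 0) := by
      rw [← integral_zero ℝ≥0 ℝ (μ := nnLebesgue)]
      refine tendsto_integral_of_dominated_convergence ((Set.Ioc 0 u).indicator G) (fun n => ?_)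
        ((integrable_indicator_iff measurableSet_Ioc).2 hGint) (fun n => ?_) ?_
      · exact ((integrable_indicator_iff measurableSet_Ioc).2
          (hGint.mono_set (Set.Ioc_subset_Ioc_left zero_le))).aestronglyMeasurable
      · refine Eventually.of_forall fun r => ?_
        have hG0 : 0 ≤ G r := Finset.sum_nonneg fun k _ => norm_nonneg _
        rw [Real.norm_of_nonneg (Set.indicator_nonneg (fun _ _ => Finset.sum_nonneg fun k _ =>
          norm_nonneg _) r)]
        exact Set.indicator_le_indicator_of_subset (Set.Ioc_subset_Ioc_left zero_le)
          (fun r => Finset.sum_nonneg fun k _ => norm_nonneg _) r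
      · filter_upwards [compl_mem_ae_iff.2 (measure_singleton u)] with r (hr : r ≠ u)
        refine tendsto_const_nhds.congr' ?_
        rcases hr.lt_or_gt with hlt | hgt
        · filter_upwards [(hslim.mono_right nhdsWithin_le_nhds).eventually (lt_mem_nhds hlt)]
            with n hn
          rw [Set.indicator_of_notMem fun h => hn.not_gt h.1]
        · exact Eventually.of_forall fun n => by
            beta_reduce
            rw [Set.indicator_of_notMem fun h => hgt.not_ge h.2]
    have hlim1 : Tendsto (fun n => ∫ ω, stateVec (X (s n) ω) i * stateVec (X u ω) j ∂Q) atTop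
        (𝓝 (∫ ω, stateVec (leftLim (fun s => X s ω) u) i * stateVec (X u ω) j ∂Q)) := by
      refine tendsto_integral_of_dominated_convergence (fun _ => 1) (fun n => ?_)
        (integrable_const _) (fun n => Eventually.of_forall fun ω => ?_)
        (Eventually.of_forall fun ω => ?_)
      · exact (((measurable_stateVec_apply i).comp (hXm _)).mul
          ((measurable_stateVec_apply j).comp (hXm _))).aestronglyMeasurable
      · rw [norm_mul]
        exact mul_le_one₀ (norm_stateVec_apply_le _ _) (norm_nonneg _) (norm_stateVec_apply_le _ _)
      · refine tendsto_const_nhds.congr' ?_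
        filter_upwards [hslim.eventually (eventually_eq_leftLim (hX.left_limit ω u))] with n hn
        rw [hn]
    exact tendsto_nhds_unique hlim1 (squeeze_zero_norm hbound hlim0)
  have hae : ∀ᵐ ω ∂Q, ∀ i j, i ≠ j →
      stateVec (leftLim (fun s => X s ω) u) i * stateVec (X u ω) j = 0 := by
    refine ae_all_iff.2 fun i => ae_all_iff.2 fun j => ?_
    by_cases hij : i = j
    · exact Eventually.of_forall fun ω h => absurd hij h
    have hnn : 0 ≤ fun ω => stateVec (leftLim (fun s => X s ω) u) i * stateVec (X u ω) j := by
      intro ω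
      simp only [Pi.zero_apply, stateVec_apply]
      positivity
    have hm : Measurable fun ω => stateVec (leftLim (fun s => X s ω) u) i * stateVec (X u ω) j :=
      ((measurable_stateVec_apply i).comp hleft).mul ((measurable_stateVec_apply j).comp (hXm _))
    have hint : Integrable
        (fun ω => stateVec (leftLim (fun s => X s ω) u) i * stateVec (X u ω) j) Q := by
      refine Integrable.of_bound hm.aestronglyMeasurable (C := 1) (Eventually.of_forall fun ω => ?_)
      rw [norm_mul]
      exact mul_le_one₀ (norm_stateVec_apply_le _ _) (norm_nonneg _) (norm_stateVec_apply_le _ _)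
    filter_upwards [(integral_eq_zero_iff_of_nonneg hnn hint).1 (key i j hij)] with ω hω _
    exact hω
  filter_upwards [hae] with ω hω
  by_contra hne
  simpa [stateVec_apply] using hω _ _ hne

variable {S : Type*} [MeasurableSpace S] {τ : S → ℝ≥0} {μ : Measure S}

/-- Integration by parts in the mean: a process `H₀ + ∫ H dμ` of bounded variation with adapted
density, paired with the indicator of a state of the chain. -/
theorem IsMarkovChain.integral_add_mul_stateVec (hA : IsRateMatrix A)
    (hX : IsMarkovChain Q A X hXm) [SFinite μ] (hτ : Measurable τ) {t T : ℝ≥0} (htT : t ≤ T)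
    (hτt : ∀ᵐ z ∂μ, t < τ z ∧ τ z ≤ T)
    {H₀ : Ω → ℝ} (hH₀ : Measurable[stateFiltration X hXm t] H₀) {C : ℝ} (hC : ∀ ω, ‖H₀ ω‖ ≤ C)
    {H : S → Ω → ℝ} (hH : Measurable fun q : S × Ω => H q.1 q.2)
    (hHad : ∀ z, t < τ z → τ z ≤ T → Measurable[stateFiltration X hXm (τ z)] (H z))
    {g : S → ℝ} (hg : Integrable g μ) (hHg : ∀ z ω, ‖H z ω‖ ≤ g z) (j : Fin N) :
    ∫ ω, (H₀ ω + ∫ z, H z ω ∂μ) * stateVec (X T ω) j ∂Q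
      = ∫ ω, H₀ ω * stateVec (X t ω) j ∂Q
        + (∫ r in Set.Ioc t T, ∑ i, A r j i *
            ∫ ω, (H₀ ω + ∫ z in {z | τ z < r}, H z ω ∂μ) * stateVec (X r ω) i ∂Q ∂nnLebesgue)
        + ∫ z, ∫ ω, H z ω * stateVec (X (τ z) ω) j ∂Q ∂μ ∧
    IntegrableOn (fun r => ∑ i, A r j i *
        ∫ ω, (H₀ ω + ∫ z in {z | τ z < r}, H z ω ∂μ) * stateVec (X r ω) i ∂Q)
      (Set.Ioc t T) nnLebesgue ∧
    Integrable (fun z => ∫ ω, H z ω * stateVec (X (τ z) ω) j ∂Q) μ := by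
  have hXj := measurable_uncurry_of_right_constant hXm hX.right_constant
  have hH₀' : Measurable H₀ := hH₀.mono ((stateFiltration X hXm).le t) le_rfl
  have hvec : ∀ (i k : Fin N) (c : ℝ), ‖c * stateVec i k‖ ≤ ‖c‖ := fun i k c => by
    rw [norm_mul]
    exact mul_le_of_le_one_right (norm_nonneg _) (norm_stateVec_apply_le _ _)
  have hgQ : Integrable (fun q : S × Ω => g q.1) (μ.prod Q) := hg.comp_fst Q
  -- `p i z r` is the mean of the density at `z` on the event that the chain is in `i` at time `r`.
  set p : Fin N → S → ℝ≥0 → ℝ := fun i z r => ∫ ω, H z ω * stateVec (X r ω) i ∂Q with hp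
  have hpm : ∀ i, Measurable fun q : S × ℝ≥0 => p i q.1 q.2 := by
    intro i
    have : Measurable fun q : (S × ℝ≥0) × Ω => H q.1.1 q.2 * stateVec (X q.1.2 q.2) i :=
      (hH.comp (measurable_fst.fst.prodMk measurable_snd)).mul
        ((measurable_stateVec_apply i).comp (hXj.comp (measurable_fst.snd.prodMk measurable_snd)))
    exact this.stronglyMeasurable.integral_prod_right'.measurable
  have hpg : ∀ i z r, ‖p i z r‖ ≤ g z := by
    intro i z r
    refine (norm_integral_le_of_norm_le_const (C := g z) (Eventually.of_forall fun ω =>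
      (hvec _ _ _).trans (hHg z ω))).trans (by simp)
  have hH₀S : ∀ r i, Integrable (fun ω => H₀ ω * stateVec (X r ω) i) Q := fun r i =>
    Integrable.of_bound (hH₀'.mul ((measurable_stateVec_apply i).comp (hXm r))).aestronglyMeasurable
      (C := C) (Eventually.of_forall fun ω => (hvec _ _ _).trans (hC ω))
  have hHS : ∀ r i, Integrable (fun q : S × Ω => H q.1 q.2 * stateVec (X r q.2) i) (μ.prod Q) :=
    fun r i => hgQ.mono' (hH.mul ((measurable_stateVec_apply i).comp
      ((hXm r).comp measurable_snd))).aestronglyMeasurable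
      (Eventually.of_forall fun q => (hvec _ _ _).trans (hHg q.1 q.2))
  -- Fubini for the density, on a subset of the time axis.
  have hswap : ∀ (B : Set S) r i, Integrable (fun ω => (∫ z in B, H z ω ∂μ) * stateVec (X r ω) i) Q
      ∧ ∫ ω, (∫ z in B, H z ω ∂μ) * stateVec (X r ω) i ∂Q = ∫ z in B, p i z r ∂μ := by
    intro B r i
    have h1 : Integrable (fun q : S × Ω => H q.1 q.2 * stateVec (X r q.2) i)
        ((μ.restrict B).prod Q) := by
      rw [← Measure.restrict_univ (μ := Q), Measure.prod_restrict]
      exact (hHS r i).restrict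
    constructor
    · refine h1.integral_prod_right.congr (Eventually.of_forall fun ω => ?_)
      exact integral_mul_const (stateVec (X r ω) i) fun z => H z ω
    · rw [hp]
      have h2 := integral_integral_swap (f := fun z ω => H z ω * stateVec (X r ω) i) h1
      rw [h2]
      congr 1 with ω
      exact (integral_mul_const (stateVec (X r ω) i) fun z => H z ω).symm
  have hsplit : ∀ (B : Set S) r i,
      ∫ ω, (H₀ ω + ∫ z in B, H z ω ∂μ) * stateVec (X r ω) i ∂Q
        = ∫ ω, H₀ ω * stateVec (X r ω) i ∂Q + ∫ z in B, p i z r ∂μ := by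
    intro B r i
    simp only [add_mul]
    rw [integral_add (hH₀S r i) (hswap B r i).1, (hswap B r i).2]
  have hH₀T := hX.integral_mul_stateVec hA htT hH₀ hC j
  have hHT : ∀ᵐ z ∂μ, p j z T = p j z (τ z)
      + ∫ r in Set.Ioc t T, {q : S × ℝ≥0 | τ q.1 < q.2}.indicator
          (fun q => ∑ i, A q.2 j i * p i q.1 q.2) (z, r) ∂nnLebesgue := by
    filter_upwards [hτt] with z hz
    have h := hX.integral_mul_stateVec hA hz.2 (hHad z hz.1 hz.2) (hHg z) j
    rw [hp]
    beta_reduce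
    rw [h, show Set.Ioc (τ z) T = Set.Ioc t T ∩ Set.Ioi (τ z) by
      rw [Set.Ioc_inter_Ioi, max_eq_right hz.1.le], Set.inter_comm,
      ← Measure.restrict_restrict measurableSet_Ioi, ← integral_indicator measurableSet_Ioi]
    rfl
  have hset : MeasurableSet {q : S × ℝ≥0 | τ q.1 < q.2} :=
    measurableSet_lt (hτ.comp measurable_fst) measurable_snd
  have hΦ1 : ∀ i, Integrable (fun q : S × ℝ≥0 => A q.2 j i * p i q.1 q.2)
      (μ.prod (nnLebesgue.restrict (Set.Ioc t T))) := by
    intro i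
    have hAi := (hA.integrableOn T j i).mono_set (Set.Ioc_subset_Ioc_left (zero_le (a := t)))
    have h1 : Integrable (fun q : S × ℝ≥0 => g q.1 * A q.2 j i)
        (μ.prod (nnLebesgue.restrict (Set.Ioc t T))) := hg.mul_prod hAi
    refine h1.mono (hAi.1.comp_snd.mul (hpm i).aestronglyMeasurable)
      (Eventually.of_forall fun q => ?_)
    rw [norm_mul, norm_mul, mul_comm]
    refine mul_le_mul_of_nonneg_right ?_ (norm_nonneg _)
    exact (hpg i q.1 q.2).trans (Real.le_norm_self _)
  have hΦ := (integrable_finsetSum Finset.univ fun i _ => hΦ1 i).indicator hset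
  have hinner : ∀ r, ∫ z, {q : S × ℝ≥0 | τ q.1 < q.2}.indicator
      (fun q => ∑ i, A q.2 j i * p i q.1 q.2) (z, r) ∂μ
        = ∑ i, A r j i * ∫ z in {z | τ z < r}, p i z r ∂μ := by
    intro r
    have hpint : ∀ i, Integrable (fun z => p i z r) μ := fun i =>
      hg.mono' ((hpm i).comp (measurable_id.prodMk measurable_const)).aestronglyMeasurable
        (Eventually.of_forall fun z => hpg i z r)
    have hBm : MeasurableSet {z | τ z < r} := measurableSet_lt hτ measurable_const
    calc ∫ z, {q : S × ℝ≥0 | τ q.1 < q.2}.indicator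
          (fun q => ∑ i, A q.2 j i * p i q.1 q.2) (z, r) ∂μ
        = ∫ z in {z | τ z < r}, ∑ i, A r j i * p i z r ∂μ := by
          rw [← integral_indicator hBm]
          rfl
      _ = ∑ i, A r j i * ∫ z in {z | τ z < r}, p i z r ∂μ := by
          rw [integral_finsetSum _ fun i _ => ((hpint i).restrict).const_mul _]
          simp only [integral_const_mul]
  have hpτ : Integrable (fun z => p j z (τ z)) μ :=
    hg.mono' ((hpm j).comp (measurable_id.prodMk hτ)).aestronglyMeasurable
      (Eventually.of_forall fun z => hpg j z (τ z))
  have hmain : ∫ z, p j z T ∂μ = ∫ z, p j z (τ z) ∂μ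
      + ∫ r in Set.Ioc t T, ∑ i, A r j i * ∫ z in {z | τ z < r}, p i z r ∂μ ∂nnLebesgue := by
    rw [integral_congr_ae hHT, integral_add hpτ hΦ.integral_prod_left]
    congr 1
    rw [integral_integral_swap (f := fun z r => {q : S × ℝ≥0 | τ q.1 < q.2}.indicator
      (fun q => ∑ i, A q.2 j i * p i q.1 q.2) (z, r)) hΦ]
    simp only [hinner]
  have hI0 : IntegrableOn (fun r => ∑ i, A r j i * ∫ ω, H₀ ω * stateVec (X r ω) i ∂Q)
      (Set.Ioc t T) nnLebesgue := by
    refine integrable_finsetSum _ fun i _ => ?_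
    refine ((hA.integrableOn T j i).mono_set (Set.Ioc_subset_Ioc_left zero_le)).mul_bdd
      (c := C) ?_ (Eventually.of_forall fun r => ?_)
    · have : Measurable fun q : ℝ≥0 × Ω => H₀ q.2 * stateVec (X q.1 q.2) i :=
        (hH₀'.comp measurable_snd).mul ((measurable_stateVec_apply i).comp hXj)
      exact this.stronglyMeasurable.integral_prod_right'.aestronglyMeasurable
    · exact (norm_integral_le_of_norm_le_const (C := C) (Eventually.of_forall fun ω =>
        (hvec _ _ _).trans (hC ω))).trans (by simp)
  have hI1 : IntegrableOn (fun r => ∑ i, A r j i * ∫ z in {z | τ z < r}, p i z r ∂μ)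
      (Set.Ioc t T) nnLebesgue := by
    exact hΦ.integral_prod_right.congr (Eventually.of_forall hinner)
  have hLHS := hsplit Set.univ T j
  rw [Measure.restrict_univ] at hLHS
  have hI : ∀ r, ∑ i, A r j i *
      ∫ ω, (H₀ ω + ∫ z in {z | τ z < r}, H z ω ∂μ) * stateVec (X r ω) i ∂Q
      = ∑ i, A r j i * ∫ ω, H₀ ω * stateVec (X r ω) i ∂Q
        + ∑ i, A r j i * ∫ z in {z | τ z < r}, p i z r ∂μ := by
    intro r
    simp only [hsplit, mul_add, Finset.sum_add_distrib]
  simp only [hI]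
  refine ⟨?_, hI0.add hI1, hpτ⟩
  rw [hLHS, hH₀T, hmain, integral_add hI0 hI1]
  ring

end Chain

/-! ### The intensity along the state process -/

/-- The matrix density of the backward equation with respect to the driving measure: the drift
`Aᵀ - L + 1` on the Lebesgue part and the jump `L - 1` at the jump times, both acting on the value
of the solution at the current time. -/
def backwardGenerator {N : ℕ} (A L : ℝ≥0 → Matrix (Fin N) (Fin N) ℝ) (z : ℝ≥0 × Bool) :
    Matrix (Fin N) (Fin N) ℝ :=
  if z.2 then L z.1 - 1 else (A z.1)ᵀ - L z.1 + 1

section Fixed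

variable {N : ℕ}

/-- The intensity along a state path: the rate `ℓ` of the state occupied just before. -/
def stateIntensity (ℓ : Fin N → ℝ≥0 → ℝ) (x : ℝ≥0 → Fin N) (u : ℝ≥0) : ℝ := ℓ (leftLim x u) u

theorem measurable_stateIntensity {P : Type*} [MeasurableSpace P] {X : ℝ≥0 → P → Fin N}
    (hX : ∀ t, Measurable (X t)) (hl : ∀ ω t, ∃ i, ∀ᶠ s in 𝓝[<] t, X s ω = i)
    {ℓ : Fin N → ℝ≥0 → ℝ} (hℓ : ∀ i, Measurable (ℓ i)) :
    Measurable fun q : P × ℝ≥0 => stateIntensity ℓ (fun s => X s q.1) q.2 := by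
  have h1 : Measurable fun q : Fin N × ℝ≥0 => ℓ q.1 q.2 :=
    measurable_from_prod_countable_right hℓ
  exact h1.comp (((measurable_leftLim_uncurry hX hl).comp measurable_swap).prodMk measurable_snd)

theorem eventually_stopped {Ω : Type*} {X : ℝ≥0 → Ω → Fin N}
    (hl : ∀ ω t, ∃ i, ∀ᶠ s in 𝓝[<] t, X s ω = i) (u : ℝ≥0) (ω : Ω)
    (t : ℝ≥0) : ∃ i, ∀ᶠ s in 𝓝[<] t, X (min s u) ω = i := by
  rcases le_or_gt t u with htu | htu
  · obtain ⟨i, hi⟩ := hl ω t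
    refine ⟨i, ?_⟩
    filter_upwards [hi, self_mem_nhdsWithin] with s hs (hst : s < t)
    rw [min_eq_left (hst.le.trans htu), hs]
  · refine ⟨X u ω, ?_⟩
    filter_upwards [nhdsWithin_le_nhds (lt_mem_nhds htu)] with s hs
    rw [min_eq_right hs.le]

theorem stateIntensity_stopped {Ω : Type*} {X : ℝ≥0 → Ω → Fin N} {ℓ : Fin N → ℝ≥0 → ℝ}
    (hl : ∀ ω t, ∃ i, ∀ᶠ s in 𝓝[<] t, X s ω = i) {u w : ℝ≥0}
    (hwu : w ≤ u) (ω : Ω) :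
    stateIntensity ℓ (fun s => X (min s u) ω) w = stateIntensity ℓ (fun s => X s ω) w := by
  rw [stateIntensity, stateIntensity, leftLim_comp_min (hl ω) hwu]

variable {Ω : Type*} [mΩ : MeasurableSpace Ω] {X : ℝ≥0 → Ω → Fin N} {hXm : ∀ t, Measurable (X t)}
  {ℓ : Fin N → ℝ≥0 → ℝ} {y : CountingPath} {T : ℝ≥0}

theorem measurable_leftPathLikelihood {P : Type*} [MeasurableSpace P] {X : ℝ≥0 → P → Fin N}
    (hX : ∀ t, Measurable (X t)) (hl : ∀ ω t, ∃ i, ∀ᶠ s in 𝓝[<] t, X s ω = i)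
    (hℓ : ∀ i, Measurable (ℓ i)) (hpos : ∀ i u, 0 < ℓ i u) :
    Measurable fun q : ℝ≥0 × P =>
      leftPathLikelihood y (stateIntensity ℓ fun s => X s q.2) T q.1 := by
  refine measurable_pathLikelihood (P := ℝ≥0 × P) (Y := fun _ => y) (fun s _ => measurable_const)
    (r := fun q w => if w < q.1 then stateIntensity ℓ (fun s => X s q.2) w else 1) ?_ ?_
  · refine Measurable.ite (measurableSet_lt measurable_snd measurable_fst.fst) ?_ measurable_const
    exact (measurable_stateIntensity hX hl hℓ).comp (measurable_fst.snd.prodMk measurable_snd)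
  · intro q w
    split_ifs
    exacts [hpos _ _, one_pos]

/-- The likelihood is adapted to the filtration of the state process. -/
theorem measurable_pathLikelihood_stateFiltration (hl : ∀ ω t, ∃ i, ∀ᶠ s in 𝓝[<] t, X s ω = i)
    (hℓ : ∀ i, Measurable (ℓ i)) (hpos : ∀ i u, 0 < ℓ i u) (t : ℝ≥0) :
    Measurable[stateFiltration X hXm t]
      fun ω => pathLikelihood y (stateIntensity ℓ fun s => X s ω) t := by
  have h := @measurable_pathLikelihood Ω (stateFiltration X hXm t) (fun _ => y) t
    (fun s _ => @measurable_const _ _ _ (stateFiltration X hXm t) _)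
    (fun ω => stateIntensity ℓ fun s => X (min s t) ω)
    (@measurable_stateIntensity N Ω (stateFiltration X hXm t) (fun s => X (min s t))
      (fun s => measurable_stateFiltration (min_le_right s t)) (eventually_stopped hl t) ℓ hℓ)
    (fun ω u => hpos _ _)
  convert h using 2 with ω
  exact pathLikelihood_congr fun u _ hu => (stateIntensity_stopped hl hu ω).symm

theorem measurable_leftPathLikelihood_stateFiltration
    (hl : ∀ ω t, ∃ i, ∀ᶠ s in 𝓝[<] t, X s ω = i)
    (hℓ : ∀ i, Measurable (ℓ i)) (hpos : ∀ i u, 0 < ℓ i u) (u : ℝ≥0) :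
    Measurable[stateFiltration X hXm u]
      fun ω => leftPathLikelihood y (stateIntensity ℓ fun s => X s ω) T u := by
  have h := @measurable_leftPathLikelihood N ℓ y T Ω (stateFiltration X hXm u)
    (fun s => X (min s u)) (fun s => measurable_stateFiltration (min_le_right s u))
    (eventually_stopped hl u) hℓ hpos
  have h' := h.comp (@measurable_prodMk_left _ _ _ (stateFiltration X hXm u) u)
  convert h' using 2 with ω
  change leftPathLikelihood y _ T u = leftPathLikelihood y _ T u
  rw [leftPathLikelihood, leftPathLikelihood]
  refine pathLikelihood_congr fun w _ _ => ?_
  split_ifs with hw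
  · exact (stateIntensity_stopped hl hw.le ω).symm
  · rfl

theorem measurable_logRate_stateFiltration
    (hl : ∀ ω t, ∃ i, ∀ᶠ s in 𝓝[<] t, X s ω = i) (z : ℝ≥0 × Bool) :
    Measurable[stateFiltration X hXm z.1]
      fun ω => logRate (stateIntensity ℓ fun s => X s ω) z := by
  have h := @measurable_leftLim_uncurry N Ω (stateFiltration X hXm z.1)
    (fun s => X (min s z.1)) (fun s => measurable_stateFiltration (min_le_right s z.1))
    (eventually_stopped hl z.1)
  have h' : Measurable[stateFiltration X hXm z.1] fun ω => leftLim (fun s => X s ω) z.1 := by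
    have h2 := h.comp (@measurable_prodMk_left _ _ _ (stateFiltration X hXm z.1) z.1)
    convert h2 using 2 with ω
    exact (leftLim_comp_min (hl ω) le_rfl).symm
  exact (measurable_of_finite fun i : Fin N => if z.2 then ℓ i z.1 - 1 else 1 - ℓ i z.1).comp h'

variable {A' : ℝ≥0 → Matrix (Fin N) (Fin N) ℝ}

theorem measurable_backwardGenerator_uncurry {P : Type*} [MeasurableSpace P]
    {ℓ : P → Fin N → ℝ≥0 → ℝ} (hA' : ∀ i j, Measurable fun u => A' u i j)
    (hℓ : ∀ i, Measurable fun q : P × ℝ≥0 => ℓ q.1 i q.2) (i j : Fin N) :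
    Measurable fun q : P × (ℝ≥0 × Bool) =>
      backwardGenerator A' (fun u => Matrix.diagonal fun i => ℓ q.1 i u) q.2 i j := by
  have hu : Measurable fun q : P × (ℝ≥0 × Bool) => q.2.1 := measurable_snd.fst
  have hA'u : Measurable fun q : P × (ℝ≥0 × Bool) => A' q.2.1 j i := (hA' j i).comp hu
  have hd : Measurable fun q : P × (ℝ≥0 × Bool) =>
      Matrix.diagonal (fun i => ℓ q.1 i q.2.1) i j := by
    by_cases hij : i = j
    · subst hij
      simp only [Matrix.diagonal_apply_eq]
      exact (hℓ i).comp (measurable_fst.prodMk hu)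
    · simp [Matrix.diagonal_apply_ne _ hij]
  have h1 : ∀ q : P × (ℝ≥0 × Bool),
      backwardGenerator A' (fun u => Matrix.diagonal fun i => ℓ q.1 i u) q.2 i j
        = if q.2.2 then Matrix.diagonal (fun i => ℓ q.1 i q.2.1) i j
            - (1 : Matrix (Fin N) (Fin N) ℝ) i j
          else A' q.2.1 j i - Matrix.diagonal (fun i => ℓ q.1 i q.2.1) i j
            + (1 : Matrix (Fin N) (Fin N) ℝ) i j := by
    intro q
    rw [backwardGenerator]
    split_ifs <;> rfl
  simp only [h1]
  exact Measurable.ite (measurable_snd.snd (measurableSet_singleton true)) (hd.sub_const _)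
    ((hA'u.sub hd).add_const _)

theorem measurable_backwardGenerator (hA' : ∀ i j, Measurable fun u => A' u i j)
    (hℓ : ∀ i, Measurable (ℓ i)) (i j : Fin N) :
    Measurable fun z => backwardGenerator A' (fun u => Matrix.diagonal fun i => ℓ i u) z i j :=
  (measurable_backwardGenerator_uncurry (P := Unit) (ℓ := fun _ => ℓ) hA'
    (fun i => (hℓ i).comp measurable_snd) i j).comp (measurable_prodMk_left (x := ()))

theorem integrable_backwardGenerator
    (hA'i : ∀ i j, IntegrableOn (fun u => A' u i j) (Set.Ioc 0 T) nnLebesgue)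
    (hℓi : ∀ i, IntegrableOn (ℓ i) (Set.Ioc 0 T) nnLebesgue) (i j : Fin N) :
    Integrable (fun z => backwardGenerator A' (fun u => Matrix.diagonal fun i => ℓ i u) z i j)
      (y.drivingMeasure T) := by
  rw [CountingPath.integrable_drivingMeasure_iff]
  have hd : IntegrableOn (fun u : ℝ≥0 => Matrix.diagonal (fun i => ℓ i u) i j) (Set.Ioc 0 T)
      nnLebesgue := by
    by_cases hij : i = j
    · subst hij; simpa using hℓi i
    · simp [Matrix.diagonal_apply_ne _ hij]
  have h1 : IntegrableOn (fun _ : ℝ≥0 => (1 : Matrix (Fin N) (Fin N) ℝ) i j) (Set.Ioc 0 T)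
      nnLebesgue := integrable_const _
  exact ((hA'i j i).sub hd).add h1

end Fixed

/-! ### The smoothing identity for a fixed observation path -/

section Fixed

variable {N : ℕ} {Ω : Type*} [mΩ : MeasurableSpace Ω] {Q : Measure Ω} [IsProbabilityMeasure Q]
  {A A' : ℝ≥0 → Matrix (Fin N) (Fin N) ℝ} {X : ℝ≥0 → Ω → Fin N} {hXm : ∀ t, Measurable (X t)}
  {ℓ : Fin N → ℝ≥0 → ℝ} {y : CountingPath} {T : ℝ≥0} {v : ℝ≥0 → Fin N → ℝ}

/-- The pairing of the density of `Z v` with the state just occupied: the rate `ℓ` cancels, and only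
the generator of the chain survives. -/
theorem sum_logRate_mul_sub_backwardGenerator_mul (ℓ : Fin N → ℝ≥0 → ℝ)
    (A' : ℝ≥0 → Matrix (Fin N) (Fin N) ℝ) (z : ℝ≥0 × Bool) (x : ℝ≥0 → Fin N) (w : Fin N → ℝ)
    {k : Fin N} (hk : leftLim x z.1 = k) :
    -(backwardGenerator A' (fun u => Matrix.diagonal fun i => ℓ i u) z *ᵥ w) k
        + logRate (stateIntensity ℓ x) z * w k
      = if z.2 then 0 else -∑ j, A' z.1 j k * w j := by
  obtain ⟨u, b⟩ := z
  simp only at hk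
  cases b
  · simp only [backwardGenerator, logRate, stateIntensity, hk, Bool.false_eq_true, if_false,
      Matrix.add_mulVec, Matrix.sub_mulVec, Matrix.one_mulVec, Pi.add_apply, Pi.sub_apply,
      Matrix.mulVec_diagonal]
    simp only [Matrix.mulVec, dotProduct, Matrix.transpose_apply]
    ring
  · simp only [backwardGenerator, logRate, stateIntensity, hk, if_true,
      Matrix.sub_mulVec, Matrix.one_mulVec, Pi.sub_apply, Matrix.mulVec_diagonal]
    ring

/-- For a fixed observation path, `Z v` is a martingale in the mean over the state process, so that
`v` turns the unnormalised filter into the unnormalised smoother. -/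
theorem IsMarkovChain.integral_pathLikelihood (hA : IsRateMatrix A) (hX : IsMarkovChain Q A X hXm)
    (hA'm : ∀ i j, Measurable fun u => A' u i j)
    (hAA' : ∀ᵐ u ∂nnLebesgue.restrict (Set.Ioc 0 T), A u = A' u)
    (hℓm : ∀ i, Measurable (ℓ i)) (hpos : ∀ i u, 0 < ℓ i u)
    (hℓi : ∀ i, IntegrableOn (ℓ i) (Set.Ioc 0 T) nnLebesgue)
    (hvm : Measurable v) {Cv : ℝ} (hCv : ∀ t, ‖v t‖ ≤ Cv)
    (hv : ∀ t, v t = 1 + ∫ z in {z | t < z.1},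
      backwardGenerator A' (fun u => Matrix.diagonal fun i => ℓ i u) z *ᵥ v z.1
        ∂y.drivingMeasure T)
    {t : ℝ≥0} (htT : t ≤ T) (i : Fin N) :
    ∫ ω, pathLikelihood y (stateIntensity ℓ fun s => X s ω) T * stateVec (X t ω) i ∂Q
      = v t i * ∫ ω, pathLikelihood y (stateIntensity ℓ fun s => X s ω) t * stateVec (X t ω) i
        ∂Q := by
  set μ := y.drivingMeasure T with hμ
  set K := backwardGenerator A' (fun u => Matrix.diagonal fun i => ℓ i u) with hK
  set r : Ω → ℝ≥0 → ℝ := fun ω => stateIntensity ℓ fun s => X s ω with hr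
  have hl := hX.left_limit
  have hA'i : ∀ i j, IntegrableOn (fun u => A' u i j) (Set.Ioc 0 T) nnLebesgue := fun i j =>
    (hA.integrableOn T i j).congr (hAA'.mono fun u hu => by simp only [hu])
  have hKm : ∀ i j, Measurable fun z => K z i j := measurable_backwardGenerator hA'm hℓm
  have hKi : ∀ i j, Integrable (fun z => K z i j) μ := integrable_backwardGenerator hA'i hℓi
  have hCv0 : 0 ≤ Cv := (norm_nonneg _).trans (hCv 0)
  have hrm := measurable_stateIntensity hXm hl hℓm
  have hrpos : ∀ ω u, 0 < r ω u := fun ω u => hpos _ _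
  -- A deterministic bound for the intensity makes the likelihood bounded.
  set R : ℝ≥0 → ℝ := fun u => 1 + ∑ i, ℓ i u with hR
  have hℓR : ∀ i u, ℓ i u ≤ R u := fun i u => by
    have := Finset.single_le_sum (f := fun i => ℓ i u) (fun i _ => (hpos i u).le)
      (Finset.mem_univ i)
    simp only [hR]
    linarith
  have hR1 : ∀ u, 1 ≤ R u := fun u => by
    simpa [hR] using Finset.sum_nonneg fun i _ => (hpos i u).le
  have hRi : IntegrableOn R (Set.Ioc 0 T) nnLebesgue :=
    (integrable_const (1 : ℝ)).add (integrable_finsetSum _ fun i _ => hℓi i)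
  have hri : ∀ ω, IntegrableOn (r ω) (Set.Ioc 0 T) nnLebesgue := fun ω =>
    hRi.mono' (hrm.comp measurable_prodMk_left).aestronglyMeasurable
      (Eventually.of_forall fun u => by
        rw [Real.norm_of_nonneg (hrpos ω u).le]; exact hℓR _ u)
  have hbound : ∀ s ≤ T, ∃ C, ∀ ω, ‖pathLikelihood y (r ω) s‖ ≤ C := fun s hs =>
    ⟨Real.exp s * ∏ u ∈ y.jumps s, R u, fun ω => by
      rw [Real.norm_of_nonneg (pathLikelihood_pos (hrpos ω) s).le]
      exact pathLikelihood_le ((hri ω).mono_set (Set.Ioc_subset_Ioc_right hs)) (hrpos ω)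
        fun u => hℓR _ u⟩
  obtain ⟨C, hC⟩ := hbound t htT
  set CL : ℝ := Real.exp T * ∏ u ∈ y.jumps T, R u with hCL
  have hleft : ∀ ω u, ‖leftPathLikelihood y (r ω) T u‖ ≤ CL := by
    intro ω u
    have hp : ∀ w, 0 < (if w < u then r ω w else 1) := fun w => by
      split_ifs
      exacts [hrpos ω w, one_pos]
    have hle : ∀ w, (if w < u then r ω w else 1) ≤ R w := fun w => by
      split_ifs
      exacts [hℓR _ w, hR1 w]
    rw [leftPathLikelihood, Real.norm_of_nonneg (pathLikelihood_pos hp T).le]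
    refine pathLikelihood_le (hRi.mono' (Measurable.ite measurableSet_Iio
      (hrm.comp measurable_prodMk_left) measurable_const).aestronglyMeasurable
      (Eventually.of_forall fun w => ?_)) hp hle
    rw [Real.norm_of_nonneg (hp w).le]
    exact hle w
  have hCL0 : 0 ≤ CL := by
    exact mul_nonneg (Real.exp_pos _).le
      (Finset.prod_nonneg fun u _ => zero_le_one.trans (hR1 u))
  -- The density of `Z v`.
  set β : Fin N → ℝ≥0 × Bool → ℝ := fun j z => -(K z *ᵥ v z.1) j with hβ
  have hKv : Integrable (fun z => K z *ᵥ v z.1) μ :=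
    integrable_mulVec hKi (hvm.comp measurable_fst).aestronglyMeasurable fun z => hCv z.1
  have hβi : ∀ j, Integrable (β j) μ := fun j => (hKv.eval j).neg
  have hβm : ∀ j, Measurable (β j) := fun j =>
    ((measurable_pi_apply j).comp (measurable_mulVec hKm (hvm.comp measurable_fst))).neg
  have hvβ : ∀ j s, v s j = v 0 j + ∫ z in {z | z.1 ≤ s}, β j z ∂μ := by
    intro j s
    have hms : MeasurableSet {z : ℝ≥0 × Bool | z.1 ≤ s} := measurable_fst measurableSet_Iic
    have h1 : ∀ s, v s j = 1 - ∫ z in {z | s < z.1}, β j z ∂μ := by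
      intro s
      rw [hv s, Pi.add_apply, eval_integral fun i => (hKv.restrict).eval i]
      simp [hβ, integral_neg]
    have h2 : ∫ z in {z | 0 < z.1}, β j z ∂μ = ∫ z, β j z ∂μ := by
      rw [Measure.restrict_eq_self_of_ae_mem]
      exact (y.ae_drivingMeasure T).mono fun z hz => hz.1
    have h3 := integral_add_compl hms (hβi j)
    rw [show {z : ℝ≥0 × Bool | z.1 ≤ s}ᶜ = {z | s < z.1} by ext; simp] at h3
    rw [h1 s, h1 0, h2, ← h3]
    ring
  set W : Fin N → ℝ≥0 × Bool → Ω → ℝ := fun j z ω =>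
    leftPathLikelihood y (r ω) T z.1 * (β j z + logRate (r ω) z * v z.1 j) with hW
  have hZv : ∀ j ω s, s ≤ T → pathLikelihood y (r ω) s * v s j
      = v 0 j + ∫ z in {z | z.1 ≤ s}, W j z ω ∂μ := fun j ω s hs =>
    pathLikelihood_mul_eq (b := fun s => v s j) (hri ω)
      (CountingPath.integrable_drivingMeasure_iff.1 (hβi j)) (fun s _ => hvβ j s) hs
  have hWm : ∀ j, Measurable fun q : (ℝ≥0 × Bool) × Ω => W j q.1 q.2 := by
    intro j
    refine ((measurable_leftPathLikelihood hXm hl hℓm hpos).comp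
      (measurable_fst.fst.prodMk measurable_snd)).mul
      (((hβm j).comp measurable_fst).add (Measurable.mul ?_
        ((measurable_pi_apply j).comp (hvm.comp measurable_fst.fst))))
    have h1 : Measurable fun q : (ℝ≥0 × Bool) × Ω => r q.2 q.1.1 :=
      hrm.comp (measurable_snd.prodMk measurable_fst.fst)
    exact Measurable.ite (measurable_fst.snd (measurableSet_singleton true))
      (h1.sub_const 1) (h1.const_sub 1)
  set g : Fin N → ℝ≥0 × Bool → ℝ := fun j z => CL * (‖β j z‖ + (1 + R z.1) * Cv) with hg
  have hgi : ∀ j, Integrable (g j) μ := by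
    intro j
    refine ((hβi j).norm.add (Integrable.mul_const ?_ Cv)).const_mul CL
    rw [CountingPath.integrable_drivingMeasure_iff]
    exact (integrable_const (1 : ℝ)).add hRi
  have hWg : ∀ j z ω, ‖W j z ω‖ ≤ g j z := by
    intro j z ω
    rw [hW, norm_mul]
    refine mul_le_mul (hleft ω z.1) ((norm_add_le _ _).trans (add_le_add le_rfl ?_))
      (norm_nonneg _) hCL0
    rw [norm_mul]
    refine mul_le_mul ?_ ((norm_le_pi_norm _ j).trans (hCv z.1)) (norm_nonneg _) ?_
    · have h1 := hrpos ω z.1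
      have h2 : r ω z.1 ≤ R z.1 := hℓR _ z.1
      rw [logRate, Real.norm_eq_abs, abs_le]
      split_ifs <;> constructor <;> linarith
    · have := hR1 z.1
      positivity
  have hWi : ∀ j ω, Integrable (fun z => W j z ω) μ := fun j ω =>
    (hgi j).mono' ((hWm j).comp measurable_prodMk_right).aestronglyMeasurable
      (Eventually.of_forall fun z => hWg j z ω)
  set ν := μ.restrict {z | t < z.1} with hν
  -- The increments of `Z v` after time `t`.
  have hincr : ∀ j ω s, t ≤ s → s ≤ T → pathLikelihood y (r ω) t * v t j
      + ∫ z in {z | z.1 ≤ s}, W j z ω ∂ν = pathLikelihood y (r ω) s * v s j := by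
    intro j ω s hts hs
    have hms : ∀ s : ℝ≥0, MeasurableSet {z : ℝ≥0 × Bool | z.1 ≤ s} := fun s =>
      measurable_fst measurableSet_Iic
    rw [hZv j ω s hs, hZv j ω t htT, hν, Measure.restrict_restrict (hms s), add_assoc]
    congr 1
    have hgt : MeasurableSet {z : ℝ≥0 × Bool | t < z.1} := measurable_fst measurableSet_Ioi
    rw [← setIntegral_union ?_ ((hms s).inter hgt)
      (hWi j ω).integrableOn (hWi j ω).integrableOn]
    · congr 2
      ext z
      simp only [Set.mem_union, Set.mem_ofPred_eq, Set.mem_inter_iff]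
      rcases le_or_gt z.1 t with h | h
      · simp [h, h.trans hts]
      · simp [h, h.not_ge]
    · refine Set.disjoint_left.2 fun z (h1 : z.1 ≤ t) h2 => h1.not_gt h2.2
  have hνT : ∀ᵐ z ∂ν, t < z.1 ∧ z.1 ≤ T := by
    have h1 : ∀ᵐ z ∂ν, t < z.1 := ae_restrict_mem (measurable_fst measurableSet_Ioi)
    filter_upwards [h1, ae_restrict_of_ae (y.ae_drivingMeasure T)] with z hz1 hz2
    exact ⟨hz1, hz2.2⟩
  have hincrT : ∀ j ω, pathLikelihood y (r ω) t * v t j + ∫ z, W j z ω ∂ν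
      = pathLikelihood y (r ω) T := by
    intro j ω
    have h1 := hincr j ω T htT le_rfl
    have h0 : ν.restrict {z | z.1 ≤ T} = ν :=
      Measure.restrict_eq_self_of_ae_mem (hνT.mono fun z hz => hz.2)
    rw [h0] at h1
    have h2 : v T = 1 := by
      rw [hv T]
      have h3 : μ.restrict {z | T < z.1} = 0 := by
        rw [Measure.restrict_eq_zero]
        refine measure_eq_zero_iff_ae_notMem.2 ((y.ae_drivingMeasure T).mono fun z hz => ?_)
        exact not_lt.2 hz.2
      simp [h3]
    rw [h1, h2, Pi.one_apply, mul_one]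
  have hincr' : ∀ j ω s, t ≤ s → s ≤ T → s ∉ y.jumps T → pathLikelihood y (r ω) t * v t j
      + ∫ z in {z | z.1 < s}, W j z ω ∂ν = leftPathLikelihood y (r ω) T s * v s j := by
    intro j ω s hts hs hsj
    rw [leftPathLikelihood_eq_of_notMem hs hsj, ← hincr j ω s hts hs]
    congr 1
    refine setIntegral_congr_set ?_
    filter_upwards [ae_restrict_of_ae (CountingPath.ae_drivingMeasure_ne hsj)] with z hz
    exact propext ⟨fun h => le_of_lt h, fun h => lt_of_le_of_ne h hz⟩
  -- Integration by parts, on the event that the chain is in state `i` at time `t`.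
  set G : Ω → ℝ := fun ω => stateVec (X t ω) i with hG
  have hG1 : ∀ ω, ‖G ω‖ ≤ 1 := fun ω => norm_stateVec_apply_le _ _
  have hGF : Measurable[stateFiltration X hXm t] G :=
    (measurable_stateVec_apply i).comp (measurable_stateFiltration le_rfl)
  have hGm : Measurable G := (measurable_stateVec_apply i).comp (hXm t)
  have hmulG : ∀ (a : ℝ) ω, ‖a * G ω‖ ≤ ‖a‖ := fun a ω => by
    rw [norm_mul]
    exact mul_le_of_le_one_right (norm_nonneg _) (hG1 ω)
  have hmain := fun j => hX.integral_add_mul_stateVec hA (μ := ν) measurable_fst htT hνT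
    (H₀ := fun ω => pathLikelihood y (r ω) t * v t j * G ω) (C := C * Cv)
    (((measurable_pathLikelihood_stateFiltration hl hℓm hpos t).mul_const _).mul hGF)
    (fun ω => (hmulG _ ω).trans (by
      rw [norm_mul]
      exact mul_le_mul (hC ω) ((norm_le_pi_norm _ j).trans (hCv t)) (norm_nonneg _)
        ((norm_nonneg _).trans (hC ω))))
    (H := fun z ω => W j z ω * G ω) ((hWm j).mul (hGm.comp measurable_snd))
    (fun z hz1 _ => ((measurable_leftPathLikelihood_stateFiltration hl hℓm hpos z.1).mul
      (((measurable_logRate_stateFiltration hl z).mul_const _).const_add _)).mul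
      (hGF.mono ((stateFiltration X hXm).mono hz1.le) le_rfl))
    ((hgi j).restrict) (fun z ω => (hmulG _ ω).trans (hWg j z ω)) j
  simp only [integral_mul_const, ← add_mul, hincrT] at hmain
  -- `Ψ` is the mean rate of change of `Z v` caused by the jumps of the chain.
  set m : Fin N → ℝ≥0 → ℝ := fun k u =>
    ∫ ω, leftPathLikelihood y (r ω) T u * G ω * stateVec (X u ω) k ∂Q with hm
  set Ψ : ℝ≥0 → ℝ := fun u => ∑ j, ∑ k, A' u j k * (v u j * m k u) with hΨ
  have hLint : ∀ k u, Integrable (fun ω => leftPathLikelihood y (r ω) T u * G ω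
      * stateVec (X u ω) k) Q := by
    intro k u
    refine Integrable.of_bound (C := CL) ((((measurable_leftPathLikelihood hXm hl hℓm hpos).comp
      measurable_prodMk_left).mul hGm).mul
      ((measurable_stateVec_apply k).comp (hXm u))).aestronglyMeasurable
      (Eventually.of_forall fun ω => ?_)
    rw [norm_mul]
    exact (mul_le_of_le_one_right (norm_nonneg _) (norm_stateVec_apply_le _ _)).trans
      ((hmulG _ ω).trans (hleft ω u))
  have hmm : ∀ k, Measurable (m k) := by
    intro k
    have hXj := measurable_uncurry_of_right_constant hXm hX.right_constant
    have h1 : Measurable fun q : ℝ≥0 × Ω =>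
        leftPathLikelihood y (r q.2) T q.1 * G q.2 * stateVec (X q.1 q.2) k :=
      ((measurable_leftPathLikelihood hXm hl hℓm hpos).mul (hGm.comp measurable_snd)).mul
        ((measurable_stateVec_apply k).comp hXj)
    exact h1.stronglyMeasurable.integral_prod_right'.measurable
  have hmb : ∀ k u, ‖m k u‖ ≤ CL := by
    intro k u
    refine (norm_integral_le_of_norm_le_const (C := CL) (Eventually.of_forall fun ω => ?_)).trans
      (by simp)
    rw [norm_mul]
    exact (mul_le_of_le_one_right (norm_nonneg _) (norm_stateVec_apply_le _ _)).trans
      ((hmulG _ ω).trans (hleft ω u))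
  have hΨi : IntegrableOn Ψ (Set.Ioc 0 T) nnLebesgue := by
    refine integrable_finsetSum _ fun j _ => integrable_finsetSum _ fun k _ => ?_
    refine (hA'i j k).mul_bdd (c := Cv * CL)
      (((measurable_pi_apply j).comp hvm).mul (hmm k)).aestronglyMeasurable
      (Eventually.of_forall fun u => ?_)
    rw [norm_mul]
    exact mul_le_mul ((norm_le_pi_norm _ j).trans (hCv u)) (hmb k u) (norm_nonneg _) hCv0
  -- Contribution of the drift of the chain.
  have hfirst : ∑ j, ∫ s in Set.Ioc t T, ∑ k, A s j k * ∫ ω, (pathLikelihood y (r ω) t * v t j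
      + ∫ z in {z | z.1 < s}, W j z ω ∂ν) * G ω * stateVec (X s ω) k ∂Q ∂nnLebesgue
      = ∫ s in Set.Ioc t T, Ψ s ∂nnLebesgue := by
    rw [← integral_finsetSum _ fun j _ => (hmain j).2.1]
    refine integral_congr_ae ?_
    filter_upwards [ae_restrict_mem measurableSet_Ioc, ae_restrict_of_ae (ae_notMem_jumps y T),
      ae_restrict_of_ae_restrict_of_subset (Set.Ioc_subset_Ioc_left zero_le) hAA']
      with s hs hsj hAs
    refine Finset.sum_congr rfl fun j _ => Finset.sum_congr rfl fun k _ => ?_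
    have h1 : ∀ ω, leftPathLikelihood y (r ω) T s * v s j * G ω * stateVec (X s ω) k
        = v s j * (leftPathLikelihood y (r ω) T s * G ω * stateVec (X s ω) k) := fun ω => by ring
    simp only [hincr' j _ s hs.1.le hs.2 hsj, h1, integral_const_mul, hAs, hm]
  -- Contribution of the density of `Z v`, where `X_{u-}` is replaced by `X_u`.
  have hsecond : ∑ j, ∫ z, ∫ ω, W j z ω * G ω * stateVec (X z.1 ω) j ∂Q ∂ν
      = -∫ s in Set.Ioc t T, Ψ s ∂nnLebesgue := by
    rw [← integral_finsetSum _ fun j _ => (hmain j).2.2]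
    have h1 : ∀ᵐ z ∂ν, ∑ j, ∫ ω, W j z ω * G ω * stateVec (X z.1 ω) j ∂Q
        = if z.2 then 0 else -Ψ z.1 := by
      filter_upwards [hνT] with z hz
      have hWint : ∀ j, Integrable (fun ω => W j z ω * G ω * stateVec (X z.1 ω) j) Q := by
        intro j
        refine Integrable.of_bound (C := g j z) ((((hWm j).comp measurable_prodMk_left).mul
          hGm).mul ((measurable_stateVec_apply j).comp (hXm z.1))).aestronglyMeasurable
          (Eventually.of_forall fun ω => ?_)
        rw [norm_mul]
        exact (mul_le_of_le_one_right (norm_nonneg _) (norm_stateVec_apply_le _ _)).trans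
          ((hmulG _ ω).trans (hWg j z ω))
      rw [← integral_finsetSum _ fun j _ => hWint j]
      have h2 : ∀ᵐ ω ∂Q, ∑ j, W j z ω * G ω * stateVec (X z.1 ω) j
          = if z.2 then 0 else -∑ j, ∑ k, A' z.1 j k * (v z.1 j *
              (leftPathLikelihood y (r ω) T z.1 * G ω * stateVec (X z.1 ω) k)) := by
        filter_upwards [hX.leftLim_ae_eq hA (zero_le.trans_lt hz.1)] with ω hω
        rw [sum_mul_stateVec (fun j => W j z ω * G ω)]
        have h3 := sum_logRate_mul_sub_backwardGenerator_mul ℓ A' z (fun s => X s ω) (v z.1) hω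
        simp only [hW, hβ]
        rw [h3]
        split_ifs
        · ring
        · rw [mul_neg, neg_mul, Finset.mul_sum, Finset.sum_mul]
          congr 1
          refine Finset.sum_congr rfl fun j _ => ?_
          have h4 := sum_mul_stateVec (fun k => A' z.1 j k * (v z.1 j *
              (leftPathLikelihood y (r ω) T z.1 * G ω))) (X z.1 ω)
          simp only [mul_assoc] at h4 ⊢
          rw [h4]
          ring
      rw [integral_congr_ae h2]
      split_ifs
      · simp
      · have h5 : ∀ j k, Integrable (fun ω => A' z.1 j k * (v z.1 j *
            (leftPathLikelihood y (r ω) T z.1 * G ω * stateVec (X z.1 ω) k))) Q :=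
          fun j k => ((hLint k z.1).const_mul _).const_mul _
        rw [integral_neg]
        refine congrArg Neg.neg ((integral_finsetSum _ fun j _ =>
          integrable_finsetSum _ fun k _ => h5 j k).trans (Finset.sum_congr rfl fun j _ =>
            (integral_finsetSum _ fun k _ => h5 j k).trans ?_))
        simp only [integral_const_mul, hm]
    rw [integral_congr_ae h1, hν]
    have h5 := CountingPath.setIntegral_drivingMeasure (y := y) (T := T)
      (f := fun z => if z.2 then 0 else -Ψ z.1) (by simpa using hΨi.neg) (Set.Ioi t)
      measurableSet_Ioi
    simp only [Bool.false_eq_true, if_false, if_true, Finset.sum_const_zero, add_zero,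
      Set.Ioc_inter_Ioi, max_eq_right (zero_le (a := t)), integral_neg] at h5
    exact h5
  have hZint : ∀ s ≤ T, ∀ (c : ℝ) k, Integrable (fun ω => pathLikelihood y (r ω) s * c * G ω
      * stateVec (X s ω) k) Q := by
    intro s hs c k
    obtain ⟨C', hC'⟩ := hbound s hs
    have hm1 : Measurable fun ω => pathLikelihood y (r ω) s :=
      (measurable_pathLikelihood_stateFiltration (hXm := hXm) hl hℓm hpos s).mono
        ((stateFiltration X hXm).le s) le_rfl
    refine Integrable.of_bound (C := C' * ‖c‖) (((hm1.mul_const c).mul hGm).mul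
      ((measurable_stateVec_apply k).comp (hXm s))).aestronglyMeasurable
      (Eventually.of_forall fun ω => ?_)
    rw [norm_mul]
    refine (mul_le_of_le_one_right (norm_nonneg _) (norm_stateVec_apply_le _ _)).trans
      ((hmulG _ ω).trans ?_)
    rw [norm_mul]
    exact mul_le_mul_of_nonneg_right (hC' ω) (norm_nonneg _)
  have hsum := Finset.sum_congr rfl fun j (_ : j ∈ Finset.univ) => (hmain j).1
  rw [Finset.sum_add_distrib, Finset.sum_add_distrib, hfirst, hsecond, add_neg_cancel_right,
    ← integral_finsetSum _ fun j _ => by simpa using hZint T le_rfl 1 j,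
    ← integral_finsetSum _ fun j _ => hZint t htT (v t j) j] at hsum
  have hR : ∀ ω, ∑ j, pathLikelihood y (r ω) t * v t j * G ω * stateVec (X t ω) j
      = v t i * (pathLikelihood y (r ω) t * G ω) := by
    intro ω
    rw [sum_mul_stateVec fun j => pathLikelihood y (r ω) t * v t j * G ω]
    simp only [hG, stateVec_apply]
    split_ifs with h
    · rw [h]; ring
    · simp
  have hL : ∀ ω, ∑ j, pathLikelihood y (r ω) T * G ω * stateVec (X T ω) j
      = pathLikelihood y (r ω) T * G ω := fun ω =>
    sum_mul_stateVec (fun _ => pathLikelihood y (r ω) T * G ω) _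
  simp only [hL, hR, integral_const_mul] at hsum
  exact hsum

end Fixed

/-! ### From the integral equation to the backward equation -/

section Tail

variable {S E : Type*} [MeasurableSpace S] {μ : Measure S} [NormedAddCommGroup E] [NormedSpace ℝ E]
  {τ : S → ℝ≥0} {g : S → E}

theorem tendsto_setIntegral_gt_nhdsGE (hτ : Measurable τ) (hg : Integrable g μ) (t : ℝ≥0) :
    Tendsto (fun s => ∫ z in {z | s < τ z}, g z ∂μ) (𝓝[≥] t)
      (𝓝 (∫ z in {z | t < τ z}, g z ∂μ)) := by
  have hm : ∀ s, MeasurableSet {z | s < τ z} := fun s => hτ measurableSet_Ioi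
  simp_rw [← fun s => integral_indicator (μ := μ) (f := g) (hm s)]
  refine tendsto_integral_filter_of_dominated_convergence (fun z => ‖g z‖)
    (Eventually.of_forall fun s => (hg.indicator (hm s)).aestronglyMeasurable)
    (Eventually.of_forall fun s => Eventually.of_forall fun z => norm_indicator_le_norm_self _ _)
    hg.norm (Eventually.of_forall fun z => tendsto_const_nhds.congr' ?_)
  rcases lt_or_ge t (τ z) with h | h
  · filter_upwards [nhdsWithin_le_nhds (gt_mem_nhds h)] with s hs
    simp [Set.indicator, h, hs]
  · filter_upwards [self_mem_nhdsWithin] with s (hs : t ≤ s)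
    simp [Set.indicator, h.not_gt, (h.trans hs).not_gt]

theorem tendsto_setIntegral_gt_nhdsLT (hτ : Measurable τ) (hg : Integrable g μ) (t : ℝ≥0) :
    Tendsto (fun s => ∫ z in {z | s < τ z}, g z ∂μ) (𝓝[<] t)
      (𝓝 (∫ z in {z | t ≤ τ z}, g z ∂μ)) := by
  have hm : ∀ s, MeasurableSet {z | s < τ z} := fun s => hτ measurableSet_Ioi
  have hm' : MeasurableSet {z | t ≤ τ z} := hτ measurableSet_Ici
  rw [← integral_indicator hm']
  simp_rw [← fun s => integral_indicator (μ := μ) (f := g) (hm s)]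
  refine tendsto_integral_filter_of_dominated_convergence (fun z => ‖g z‖)
    (Eventually.of_forall fun s => (hg.indicator (hm s)).aestronglyMeasurable)
    (Eventually.of_forall fun s => Eventually.of_forall fun z => norm_indicator_le_norm_self _ _)
    hg.norm (Eventually.of_forall fun z => tendsto_const_nhds.congr' ?_)
  rcases le_or_gt t (τ z) with h | h
  · filter_upwards [self_mem_nhdsWithin] with s (hs : s < t)
    simp [Set.indicator, h, hs.trans_le h]
  · filter_upwards [nhdsWithin_le_nhds (lt_mem_nhds h)] with s hs
    simp [Set.indicator, h.not_ge, hs.le.not_gt]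

end Tail

section BackwardEquation

variable {N : ℕ} {A : ℝ≥0 → Matrix (Fin N) (Fin N) ℝ} {ℓ : Fin N → ℝ≥0 → ℝ} {y : CountingPath}
  {T : ℝ≥0} {v : ℝ≥0 → Fin N → ℝ}

theorem inv_diagonal_sub_one_mulVec {d : Fin N → ℝ} (hd : ∀ i, 0 < d i) (w : Fin N → ℝ) :
    ((Matrix.diagonal d)⁻¹ - 1) *ᵥ (Matrix.diagonal d *ᵥ w)
      = -((Matrix.diagonal d - 1) *ᵥ w) := by
  have hu : IsUnit (Matrix.diagonal d).det := by
    rw [Matrix.det_diagonal]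
    exact (Finset.prod_pos fun i _ => hd i).ne'.isUnit
  rw [Matrix.sub_mulVec, Matrix.mulVec_mulVec, Matrix.nonsing_inv_mul _ hu, Matrix.sub_mulVec,
    Matrix.one_mulVec, Matrix.one_mulVec, neg_sub]

/-- A bounded solution of the backward integral equation against the driving measure is càdlàg and
solves the backward equation. In the integral equation the coefficients act on `v_u`, in the
backward equation on `v_{u-}`; the two differ at the jumps only, where `v_{u-} = Λ_u v_u`. -/
theorem SolvesBackward.of_eq_integral
    (hAi : ∀ i j, IntegrableOn (fun u => A u i j) (Set.Ioc 0 T) nnLebesgue)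
    (hℓi : ∀ i, IntegrableOn (ℓ i) (Set.Ioc 0 T) nnLebesgue) (hpos : ∀ i u, 0 < ℓ i u)
    (hvm : Measurable v) {C : ℝ} (hC : ∀ t, ‖v t‖ ≤ C)
    (hv : ∀ t, v t = 1 + ∫ z in {z | t < z.1},
      backwardGenerator A (fun u => Matrix.diagonal fun i => ℓ i u) z *ᵥ v z.1
        ∂y.drivingMeasure T) :
    SolvesBackward A (fun u => Matrix.diagonal fun i => ℓ i u) y T v := by
  classical
  set L : ℝ≥0 → Matrix (Fin N) (Fin N) ℝ := fun u => Matrix.diagonal fun i => ℓ i u with hL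
  set g : ℝ≥0 × Bool → Fin N → ℝ := fun z => backwardGenerator A L z *ᵥ v z.1 with hg
  have hgi : Integrable g (y.drivingMeasure T) :=
    integrable_mulVec (integrable_backwardGenerator hAi hℓi)
      (hvm.comp measurable_fst).aestronglyMeasurable fun z => hC z.1
  have hgi' : IntegrableOn (fun u => g (u, false)) (Set.Ioc 0 T) nnLebesgue :=
    CountingPath.integrable_drivingMeasure_iff.1 hgi
  have hleft : ∀ t, Tendsto v (𝓝[<] t) (𝓝 (1 + ∫ z in {z | t ≤ z.1}, g z ∂y.drivingMeasure T)) :=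
    fun t => by
      rw [show v = fun t => 1 + ∫ z in {z | t < z.1}, g z ∂y.drivingMeasure T from funext hv]
      exact (tendsto_setIntegral_gt_nhdsLT measurable_fst hgi t).const_add 1
  have hleftLim : ∀ t, 0 < t → leftLim v t = v t + if t ∈ y.jumps T then g (t, true) else 0 := by
    intro t ht
    have := nnreal_nhdsLT_neBot ht
    rw [leftLim_eq_of_tendsto (hleft t), hv t]
    have h1 : {z : ℝ≥0 × Bool | t ≤ z.1} = {z | t < z.1} ∪ {z | z.1 ∈ ({t} : Set ℝ≥0)} := by
      ext z
      simp [le_iff_lt_or_eq, eq_comm]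
    have h2 : Disjoint {z : ℝ≥0 × Bool | t < z.1} {z | z.1 ∈ ({t} : Set ℝ≥0)} :=
      Set.disjoint_left.2 fun z (h1 : t < z.1) (h2 : z.1 = t) => h1.ne' h2
    rw [h1, setIntegral_union h2 (measurable_fst (measurableSet_singleton t)) hgi.integrableOn
      hgi.integrableOn,
      CountingPath.setIntegral_drivingMeasure hgi' {t} (measurableSet_singleton t),
      setIntegral_measure_zero _ (measure_mono_null Set.inter_subset_right (measure_singleton t)),
      zero_add, ← add_assoc]
    congr 1
    simp [Finset.filter_eq']
    split_ifs <;> simp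
  have hdrift : (fun u => ((A u)ᵀ - L u + 1) *ᵥ leftLim v u)
      =ᵐ[nnLebesgue.restrict (Set.Ioc 0 T)] fun u => g (u, false) := by
    filter_upwards [ae_restrict_mem measurableSet_Ioc, ae_restrict_of_ae (ae_notMem_jumps y T)]
      with u hu huj
    rw [hleftLim u hu.1, if_neg huj, add_zero]
    simp [hg, backwardGenerator]
  have hjump : ∀ u ∈ y.jumps T, ((L u)⁻¹ - 1) *ᵥ leftLim v u = -g (u, true) := by
    intro u hu
    have h1 : leftLim v u = L u *ᵥ v u := by
      rw [hleftLim u (CountingPath.mem_jumps.1 hu).1, if_pos hu]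
      simp [hg, backwardGenerator, Matrix.sub_mulVec]
    rw [h1, hL, inv_diagonal_sub_one_mulVec (fun i => hpos i u)]
    simp [hg, hL, backwardGenerator]
  refine ⟨fun t _ => ?_, fun t _ => ⟨_, hleft t⟩, ?_, ?_, fun t ht => ?_⟩
  · have h1 := (tendsto_setIntegral_gt_nhdsGE measurable_fst hgi t).const_add (1 : Fin N → ℝ)
    rw [← hv t] at h1
    exact h1.congr fun s => (hv s).symm
  · have h1 : {z : ℝ≥0 × Bool | T < z.1} =ᵐ[y.drivingMeasure T] (∅ : Set (ℝ≥0 × Bool)) := by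
      filter_upwards [y.ae_drivingMeasure T] with z hz
      exact propext ⟨fun h => absurd h (not_lt.2 hz.2), fun h => h.elim⟩
    rw [hv T, setIntegral_congr_set h1]
    simp
  · exact (intervalIntegrable_toNNReal_iff _ _).2 (hgi'.congr hdrift.symm)
  · have hm : MeasurableSet {z : ℝ≥0 × Bool | z.1 ≤ t} := measurable_fst measurableSet_Iic
    have h0 : (y.drivingMeasure T).restrict {z | 0 < z.1} = y.drivingMeasure T :=
      Measure.restrict_eq_self_of_ae_mem ((y.ae_drivingMeasure T).mono fun z hz => hz.1)
    have h1 : ∫ z in {z | z.1 ≤ t}, g z ∂y.drivingMeasure T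
        + ∫ z in {z | t < z.1}, g z ∂y.drivingMeasure T = ∫ z, g z ∂y.drivingMeasure T := by
      rw [show {z : ℝ≥0 × Bool | t < z.1} = {z | z.1 ≤ t}ᶜ by ext; simp]
      exact integral_add_compl hm hgi
    have h2 : v 0 = 1 + ∫ z, g z ∂y.drivingMeasure T := by rw [hv 0, h0]
    have h3 : v t = v 0 - ∫ z in {z | z.1 ≤ t}, g z ∂y.drivingMeasure T := by
      rw [h2, ← h1, hv t]
      abel
    rw [h3, CountingPath.setIntegral_drivingMeasure_le hgi' ht,
      intervalIntegral_toNNReal (fun u => ((A u)ᵀ - L u + 1) *ᵥ leftLim v u) t,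
      integral_congr_ae (ae_restrict_of_ae_restrict_of_subset
        (Set.Ioc_subset_Ioc_right ht) hdrift), Finset.sum_congr rfl fun u hu => hjump u ?_,
      Finset.sum_neg_distrib]
    · abel
    · rw [← y.filter_jumps ht] at hu
      exact (Finset.mem_filter.1 hu).1

end BackwardEquation

/-! ### Measurable dependence on the observations -/

section Observation

variable {Ω : Type*} [mΩ : MeasurableSpace Ω] {Y : Ω → CountingPath}
  {hYm : ∀ t, Measurable fun ω => Y ω t}

theorem measurable_obsFiltration {s t : ℝ≥0} (hst : s ≤ t) :
    Measurable[obsFiltration Y hYm t] fun ω => Y ω s := by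
  rw [measurable_iff_comap_le]
  exact le_iSup₂_of_le (f := fun s (_ : s ≤ t) => MeasurableSpace.comap (fun ω => Y ω s) _) s hst
    le_rfl

theorem measurable_obsFiltration_path (t : ℝ≥0) :
    Measurable[obsFiltration Y hYm t, CountingPath.filtration t] Y := by
  rw [measurable_iff_comap_le]
  change MeasurableSpace.comap Y
    (⨆ s ≤ t, MeasurableSpace.comap (fun y : CountingPath => y s) _) ≤ _
  simp only [MeasurableSpace.comap_iSup, MeasurableSpace.comap_comp]
  exact iSup₂_le fun s hs => (measurable_obsFiltration hs).comap_le

/-- A predictable functional of the counting path, stopped in time at `t`, is jointly measurable in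
time and in the observations up to `t`. -/
theorem measurable_predictable_min {f : ℝ≥0 × CountingPath → ℝ}
    (hf : Measurable[CountingPath.filtration.predictable] f) (t : ℝ≥0) :
    Measurable[(obsFiltration Y hYm t).prod inferInstance]
      fun q : Ω × ℝ≥0 => f (min q.2 t, Y q.1) := by
  have hY := measurable_obsFiltration_path (hYm := hYm) t
  have hincl := measurable_inclusion_predictable (𝓕 := CountingPath.filtration) (i := t)
  have hpair : @Measurable (Ω × ℝ≥0) (Set.Iic t × CountingPath)
      ((obsFiltration Y hYm t).prod inferInstance)
      (Subtype.instMeasurableSpace.prod (CountingPath.filtration t))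
      fun q => (⟨min q.2 t, Set.mem_Iic.2 (min_le_right _ _)⟩, Y q.1) := by
    refine Measurable.prodMk (Measurable.subtype_mk ?_) ?_
    · exact (@measurable_snd _ _ (obsFiltration Y hYm t) _).min
        (@measurable_const _ _ _ ((obsFiltration Y hYm t).prod inferInstance) t)
    · exact hY.comp (@measurable_fst _ _ (obsFiltration Y hYm t) _)
  exact hf.comp (hincl.comp hpair)

end Observation

section Solution

variable {P : Type*} [MeasurableSpace P] {N : ℕ} {A : ℝ≥0 → Matrix (Fin N) (Fin N) ℝ}
  {ℓ : P → Fin N → ℝ≥0 → ℝ} {Y : P → CountingPath} {T : ℝ≥0}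

/-- The backward integral equation has a solution that depends measurably on the observations. -/
theorem exists_backward_solution (hYm : ∀ s ≤ T, Measurable fun p => Y p s)
    (hAm : ∀ i j, Measurable fun u => A u i j)
    (hAi : ∀ i j, IntegrableOn (fun u => A u i j) (Set.Ioc 0 T) nnLebesgue)
    (hℓ : ∀ i, Measurable fun q : P × ℝ≥0 => ℓ q.1 i q.2) :
    ∃ v : ℝ≥0 → P → Fin N → ℝ, (Measurable fun q : ℝ≥0 × P => v q.1 q.2) ∧
      (∀ p, ∃ C, ∀ t, ‖v t p‖ ≤ C) ∧
      ∀ p, (∀ i, IntegrableOn (ℓ p i) (Set.Ioc 0 T) nnLebesgue) → ∀ t,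
        v t p = 1 + ∫ z in {z | t < z.1},
          backwardGenerator A (fun u => Matrix.diagonal fun i => ℓ p i u) z *ᵥ v z.1 p
            ∂(Y p).drivingMeasure T := by
  classical
  -- On the exceptional set where the rates are not integrable, the coefficients are set to zero.
  set G : Set P := {p | ∀ i, ∫⁻ u in Set.Ioc 0 T, ‖ℓ p i u‖ₑ ∂nnLebesgue < ∞} with hG
  have hGm : MeasurableSet G := by
    rw [hG, Set.ofPred_forall]
    exact MeasurableSet.iInter fun i =>
      measurableSet_lt (hℓ i).enorm.lintegral_prod_right' measurable_const
  have hGi : ∀ p, p ∈ G ↔ ∀ i, IntegrableOn (ℓ p i) (Set.Ioc 0 T) nnLebesgue := fun p =>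
    forall_congr' fun i => ⟨fun h => ⟨((hℓ i).comp measurable_prodMk_left).aestronglyMeasurable, h⟩,
      fun h => h.2⟩
  obtain ⟨v, hvm, hvb, hv⟩ := exists_backward_volterra
    (κ := CountingPath.drivingKernel T Y hYm) (τ := Prod.fst)
    (K := fun p z => if p ∈ G then
      backwardGenerator A (fun u => Matrix.diagonal fun i => ℓ p i u) z else 0) measurable_fst
    (fun i j => by
      have h : ∀ q : P × (ℝ≥0 × Bool), (if q.1 ∈ G then
          backwardGenerator A (fun u => Matrix.diagonal fun i => ℓ q.1 i u) q.2 else 0) i j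
          = if q.1 ∈ G then
            backwardGenerator A (fun u => Matrix.diagonal fun i => ℓ q.1 i u) q.2 i j else 0 :=
        fun q => by split_ifs <;> rfl
      simp only [h]
      exact Measurable.ite (measurable_fst hGm) (measurable_backwardGenerator_uncurry hAm hℓ i j)
        measurable_const)
    (fun p i j => by
      by_cases hp : p ∈ G
      · simp only [if_pos hp]
        exact integrable_backwardGenerator hAi ((hGi p).1 hp) i j
      · simp [if_neg hp])
  refine ⟨v, hvm, hvb, fun p hp t => ?_⟩
  rw [hv t p]
  simp only [if_pos ((hGi p).2 hp)]
  rfl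

end Solution

/-! ### Filter and smoother as integrals over the state process -/

/-- Conditioning on one of two independent variables integrates out the other. -/
theorem condExp_comap_of_indepFun {Ω S R E : Type*} [mΩ : MeasurableSpace Ω] [MeasurableSpace S]
    [mR : MeasurableSpace R] [NormedAddCommGroup E] [NormedSpace ℝ E] [CompleteSpace E]
    {Q : Measure Ω} [IsProbabilityMeasure Q] {f : Ω → S} {g : Ω → R} (hf : Measurable f)
    (hg : Measurable g) (hfg : IndepFun f g Q) {F : S × R → E} (hF : StronglyMeasurable F)
    (hFi : Integrable (fun ω => F (f ω, g ω)) Q) :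
    Q[fun ω => F (f ω, g ω) | MeasurableSpace.comap g mR]
        =ᵐ[Q] (fun ω => ∫ ω', F (f ω', g ω) ∂Q)
      ∧ ∀ᵐ ω ∂Q, Integrable (fun ω' => F (f ω', g ω)) Q := by
  have hmap := hfg.map_prod_eq_prod_map_map hf.aemeasurable hg.aemeasurable
  have := Measure.isProbabilityMeasure_map (μ := Q) hf.aemeasurable
  have := Measure.isProbabilityMeasure_map (μ := Q) hg.aemeasurable
  have hFp : Integrable F ((Q.map f).prod (Q.map g)) := by
    rw [← hmap]
    exact (integrable_map_measure hF.aestronglyMeasurable (hf.prodMk hg).aemeasurable).2 hFi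
  have hinner : ∀ r, ∫ s, F (s, r) ∂Q.map f = ∫ ω', F (f ω', r) ∂Q := fun r =>
    integral_map hf.aemeasurable (hF.comp_measurable measurable_prodMk_right).aestronglyMeasurable
  have hsec : StronglyMeasurable fun r => ∫ ω', F (f ω', r) ∂Q := by
    simp only [← hinner]
    exact hF.integral_prod_left'
  have hseci : Integrable (fun ω => ∫ ω', F (f ω', g ω) ∂Q) Q := by
    refine (integrable_map_measure hsec.aestronglyMeasurable hg.aemeasurable).1 ?_
    simp only [← hinner]
    exact hFp.integral_prod_right
  refine ⟨?_, ?_⟩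
  · symm
    refine ae_eq_condExp_of_forall_setIntegral_eq hg.comap_le hFi
      (fun s _ _ => hseci.integrableOn) ?_
      (hsec.comp_measurable (comap_measurable g)).aestronglyMeasurable
    rintro _ ⟨B, hB, rfl⟩ -
    have h1 : ∫ ω in g ⁻¹' B, F (f ω, g ω) ∂Q
        = ∫ q in Set.univ ×ˢ B, F q ∂((Q.map f).prod (Q.map g)) := by
      rw [← hmap, setIntegral_map (MeasurableSet.univ.prod hB) hF.aestronglyMeasurable
        (hf.prodMk hg).aemeasurable]
      congr 2
      ext ω
      simp
    rw [h1, ← Measure.prod_restrict, Measure.restrict_univ, integral_prod_symm]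
    · simp only [hinner]
      exact (setIntegral_map hB hsec.aestronglyMeasurable hg.aemeasurable).symm
    · rw [← Measure.restrict_univ (μ := Q.map f), Measure.prod_restrict]
      exact hFp.integrableOn
  · have h1 := hFp.prod_left_ae
    filter_upwards [ae_of_ae_map hg.aemeasurable h1] with ω hω
    exact (integrable_map_measure (hF.comp_measurable measurable_prodMk_right).aestronglyMeasurable
      hf.aemeasurable).1 hω

theorem measurable_pathLikelihood_prod {P R : Type*} [MeasurableSpace P] [MeasurableSpace R] {N : ℕ}
    {X : ℝ≥0 → P → Fin N} (hX : ∀ t, Measurable (X t))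
    (hl : ∀ ω t, ∃ i, ∀ᶠ s in 𝓝[<] t, X s ω = i) {Y : R → CountingPath} {t : ℝ≥0}
    (hY : ∀ s ≤ t, Measurable fun p => Y p s) {ℓ : R → Fin N → ℝ≥0 → ℝ}
    (hℓ : ∀ i, Measurable fun q : R × ℝ≥0 => ℓ q.1 i q.2) (hpos : ∀ p i u, 0 < ℓ p i u) :
    Measurable fun q : P × R =>
      pathLikelihood (Y q.2) (stateIntensity (ℓ q.2) fun s => X s q.1) t := by
  refine measurable_pathLikelihood (P := P × R) (Y := fun q => Y q.2)
    (r := fun q => stateIntensity (ℓ q.2) fun s => X s q.1)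
    (fun s hs => (hY s hs).comp measurable_snd) ?_ fun q u => hpos _ _ _
  have h1 : Measurable fun q : Fin N × (R × ℝ≥0) => ℓ q.2.1 q.1 q.2.2 :=
    measurable_from_prod_countable_right hℓ
  have h2 : Measurable fun q : (P × R) × ℝ≥0 => leftLim (fun s => X s q.1.1) q.2 :=
    (measurable_leftLim_uncurry hX hl).comp (measurable_snd.prodMk measurable_fst.fst)
  exact h1.comp (h2.prodMk (measurable_fst.snd.prodMk measurable_snd))

variable {Ω : Type*} [mΩ : MeasurableSpace Ω] {Q : Measure Ω} [IsProbabilityMeasure Q] {N : ℕ}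
  {X : ℝ≥0 → Ω → Fin N} {Y : Ω → CountingPath} {hYm : ∀ t, Measurable fun ω => Y ω t}
  {lam : Fin N → ℝ≥0 → CountingPath → ℝ}

/-- Since `X` and `Y` are independent, conditioning `Z_t X_s` on the observations up to time `t`
amounts to integrating over the state process with the observation path held fixed. -/
theorem condExp_likelihood_smul_stateVec (hXm : ∀ t, Measurable (X t))
    (hl : ∀ ω t, ∃ i, ∀ᶠ s in 𝓝[<] t, X s ω = i) (hXY : IndepProcesses Q X Y)
    (hpos : ∀ i t y, 0 < lam i t y)
    (hpred : ∀ i, Measurable[CountingPath.filtration.predictable]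
      fun p : ℝ≥0 × CountingPath => lam i p.1 p.2)
    {t : ℝ≥0} (hint : Integrable (likelihood lam X Y t) Q) (s : ℝ≥0) :
    Q[fun ω => likelihood lam X Y t ω • stateVec (X s ω) | obsFiltration Y hYm t]
        =ᵐ[Q] (fun ω => ∫ ω', pathLikelihood (Y ω)
          (stateIntensity (fun i u => lam i u (Y ω)) fun s => X s ω') t • stateVec (X s ω') ∂Q)
      ∧ ∀ᵐ ω ∂Q, Integrable (fun ω' => pathLikelihood (Y ω)
          (stateIntensity (fun i u => lam i u (Y ω)) fun s => X s ω') t • stateVec (X s ω')) Q := by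
  have hX' : ∀ t, Measurable[MeasurableSpace.comap (fun ω t => X t ω) inferInstance] (X t) :=
    fun t => by
      rw [measurable_iff_comap_le, show X t = (fun x : ℝ≥0 → Fin N => x t) ∘ fun ω t => X t ω
        from rfl, ← MeasurableSpace.comap_comp]
      exact MeasurableSpace.comap_mono (measurable_pi_apply t).comap_le
  have hXΩ : MeasurableSpace.comap (fun ω t => X t ω) inferInstance ≤ mΩ :=
    (measurable_pi_lambda _ hXm).comap_le
  have hYΩ : obsFiltration Y hYm t ≤ mΩ := (obsFiltration Y hYm).le t
  have hY' : (obsFiltration Y hYm t : MeasurableSpace Ω)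
      ≤ MeasurableSpace.comap (fun ω t => Y ω t) inferInstance := by
    change ⨆ s ≤ t, MeasurableSpace.comap (fun ω => Y ω s) _ ≤ _
    refine iSup₂_le fun u _ => ?_
    rw [show (fun ω => Y ω u) = (fun y : ℝ≥0 → ℕ => y u) ∘ fun ω t => Y ω t from rfl,
      ← MeasurableSpace.comap_comp]
    exact MeasurableSpace.comap_mono (measurable_pi_apply u).comap_le
  have hind : @IndepFun Ω Ω Ω mΩ (MeasurableSpace.comap (fun ω t => X t ω) inferInstance)
      (obsFiltration Y hYm t) id id Q := by
    rw [@IndepFun_iff_Indep, MeasurableSpace.comap_id, MeasurableSpace.comap_id]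
    exact indep_of_indep_of_le_right ((IndepFun_iff_Indep _ _ _).1 hXY) hY'
  set F : Ω × Ω → Fin N → ℝ := fun q => pathLikelihood (Y q.2)
    (stateIntensity (fun i u => lam i (min u t) (Y q.2)) fun s => X s q.1) t • stateVec (X s q.1)
    with hF
  have hFeq : ∀ ω' ω, F (ω', ω) = pathLikelihood (Y ω)
      (stateIntensity (fun i u => lam i u (Y ω)) fun s => X s ω') t • stateVec (X s ω') := by
    intro ω' ω
    simp only [hF]
    congr 1
    refine pathLikelihood_congr fun u _ hu => ?_
    simp only [stateIntensity, min_eq_left hu]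
  have hFm : Measurable[(MeasurableSpace.comap (fun ω t => X t ω) inferInstance).prod
      (obsFiltration Y hYm t)] F :=
    @Measurable.smul ℝ (Fin N → ℝ) _ _ _ _ (_) _ _ _
      (@measurable_pathLikelihood_prod Ω Ω (MeasurableSpace.comap (fun ω t => X t ω) inferInstance)
        (obsFiltration Y hYm t) N X hX' hl Y t
        (fun s hs => measurable_obsFiltration hs) (fun ω i u => lam i (min u t) (Y ω))
        (fun i => measurable_predictable_min (hYm := hYm) (hpred i) t) (fun _ _ _ => hpos _ _ _))
      ((measurable_of_finite stateVec).comp ((hX' s).comp (@measurable_fst _ _ _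
        (obsFiltration Y hYm t))))
  have hFi : Integrable (fun ω => F (ω, ω)) Q := by
    refine (hint.norm.mono' (f := fun ω => F (ω, ω)) ?_ ?_)
    · simp only [hFeq]
      exact hint.aestronglyMeasurable.smul
        ((measurable_of_finite stateVec).comp (hXm s)).aestronglyMeasurable
    · refine Eventually.of_forall fun ω => ?_
      rw [hFeq, norm_smul]
      exact mul_le_of_le_one_right (norm_nonneg _) (norm_stateVec_le _)
  have h := @condExp_comap_of_indepFun Ω Ω Ω (Fin N → ℝ) mΩ
    (MeasurableSpace.comap (fun ω t => X t ω) inferInstance) (obsFiltration Y hYm t) _ _ _ Q _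
    id id (measurable_id'' hXΩ) (measurable_id'' hYΩ) hind F hFm.stronglyMeasurable hFi
  rw [MeasurableSpace.comap_id] at h
  simp only [id, hFeq] at h
  exact h

end

theorem mainTheorem2 {Ω : Type*} [mΩ : MeasurableSpace Ω] (Q : Measure Ω) [IsProbabilityMeasure Q]
    {N : ℕ} (A : ℝ≥0 → Matrix (Fin N) (Fin N) ℝ) (hA : IsRateMatrix A)
    (X : ℝ≥0 → Ω → Fin N) (hXm : ∀ t, Measurable (X t)) (hX : IsMarkovChain Q A X hXm)
    (Y : Ω → CountingPath) (hYm : ∀ t, Measurable (fun ω => Y ω t)) (hY : IsStandardPoisson Q Y)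
    (hXY : IndepProcesses Q X Y)
    (T : ℝ≥0) (lam : Fin N → ℝ≥0 → CountingPath → ℝ) (hlam : IsRateFunction Q lam X Y T)
    (hZ : Martingale (fun t => likelihood lam X Y (min t T)) (fullFiltration X hXm Y hYm) Q) :
    ∃ v : ℝ≥0 → Ω → Fin N → ℝ,
      (∀ t, t ≤ T → Measurable[obsFiltration Y hYm T] (v t)) ∧
      (∀ t, t ≤ T → smoothedDensity Q lam X Y hYm T t
        =ᵐ[Q] fun ω => Matrix.diagonal (v t ω) *ᵥ filterDensity Q lam X Y hYm t ω) ∧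
      ∀ᵐ ω ∂Q, SolvesBackward A (rateDiag lam (Y ω)) (Y ω) T (fun t => v t ω) := by
  have hAi := hA.integrableOn T
  -- The rates of the chain are only Lebesgue measurable in time; the solution is built from a
  -- Borel version.
  set A' : ℝ≥0 → Matrix (Fin N) (Fin N) ℝ := fun u i j => (hAi i j).aestronglyMeasurable.mk _ u
  have hA'm : ∀ i j, Measurable fun u => A' u i j := fun i j =>
    (hAi i j).aestronglyMeasurable.stronglyMeasurable_mk.measurable
  have hAA' : ∀ᵐ u ∂nnLebesgue.restrict (Set.Ioc 0 T), A u = A' u := by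
    filter_upwards [ae_all_iff.2 fun i => ae_all_iff.2 fun j =>
      (hAi i j).aestronglyMeasurable.ae_eq_mk] with u hu
    ext i j
    exact hu i j
  have hA'i : ∀ i j, IntegrableOn (fun u => A' u i j) (Set.Ioc 0 T) nnLebesgue := fun i j =>
    (hAi i j).congr (hAA'.mono fun u hu => by simp only [hu])
  -- Stopping the rates at time `T` makes them measurable in time and in the observations up to `T`.
  set ℓ : Ω → Fin N → ℝ≥0 → ℝ := fun ω i u => lam i (min u T) (Y ω)
  have hℓm : ∀ i, Measurable[(obsFiltration Y hYm T).prod inferInstance]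
      fun q : Ω × ℝ≥0 => ℓ q.1 i q.2 := fun i =>
    measurable_predictable_min (hYm := hYm) (hlam.predictable i) T
  have hℓi : ∀ᵐ ω ∂Q, ∀ i, IntegrableOn (fun u => lam i u (Y ω)) (Set.Ioc 0 T) nnLebesgue := by
    filter_upwards [ae_all_iff.2 hlam.integrable] with ω hω i
    exact (intervalIntegrable_toNNReal_iff (fun u => lam i u (Y ω)) T).1 (hω i)
  have hℓi' : ∀ {ω}, (∀ i, IntegrableOn (fun u => lam i u (Y ω)) (Set.Ioc 0 T) nnLebesgue) →
      ∀ i, IntegrableOn (ℓ ω i) (Set.Ioc 0 T) nnLebesgue := fun {ω} h i =>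
    (h i).congr_fun (fun u hu => by simp only [ℓ, min_eq_left hu.2]) measurableSet_Ioc
  obtain ⟨v, hvm, hvb, hv⟩ := @exists_backward_solution Ω (obsFiltration Y hYm T) N A' ℓ Y T
    (fun s hs => measurable_obsFiltration hs) hA'm hA'i hℓm
  have hvω : ∀ ω, Measurable fun t => v t ω := fun ω =>
    hvm.comp (@measurable_prodMk_right _ _ _ (obsFiltration Y hYm T) ω)
  have hZi : ∀ t ≤ T, Integrable (likelihood lam X Y t) Q := fun t ht => by
    simpa only [min_eq_left ht] using hZ.integrable t
  refine ⟨v, fun t _ => hvm.comp (@measurable_prodMk_left _ _ _ (obsFiltration Y hYm T) t),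
    fun t ht => ?_, ?_⟩
  · obtain ⟨hr, hri⟩ := condExp_likelihood_smul_stateVec (hYm := hYm) hXm hX.left_limit hXY
      hlam.pos hlam.predictable (hZi T le_rfl) t
    obtain ⟨hq, hqi⟩ := condExp_likelihood_smul_stateVec (hYm := hYm) hXm hX.left_limit hXY
      hlam.pos hlam.predictable (hZi t ht) t
    filter_upwards [hr, hri, hq, hqi, hℓi] with ω hrω hriω hqω hqiω hℓω
    obtain ⟨C, hC⟩ := hvb ω
    have hkey := hX.integral_pathLikelihood (ℓ := ℓ ω) (v := fun t => v t ω) hA hA'm hAA'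
      (fun i => (hℓm i).comp (@measurable_prodMk_left _ _ (obsFiltration Y hYm T) _ ω))
      (fun i u => hlam.pos i _ _) (hℓi' hℓω) (hvω ω) hC (hv ω (hℓi' hℓω)) ht
    have hcongr : ∀ s ≤ T, ∀ ω', pathLikelihood (Y ω) (stateIntensity (ℓ ω) fun s => X s ω') s
        = pathLikelihood (Y ω) (stateIntensity (fun i u => lam i u (Y ω)) fun s => X s ω') s :=
      fun s hs ω' => pathLikelihood_congr fun u _ hu => by
        simp only [stateIntensity, ℓ, min_eq_left (hu.trans hs)]
    simp only [hcongr T le_rfl, hcongr t ht] at hkey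
    rw [smoothedDensity, filterDensity, hrω, hqω]
    ext i
    rw [Matrix.mulVec_diagonal, eval_integral fun i => hriω.eval i,
      eval_integral fun i => hqiω.eval i]
    exact hkey i
  · filter_upwards [hℓi] with ω hω
    obtain ⟨C, hC⟩ := hvb ω
    refine SolvesBackward.of_eq_integral (ℓ := fun i u => lam i u (Y ω)) hAi hω
      (fun i u => hlam.pos i u _) (hvω ω) hC fun t => ?_
    rw [hv ω (hℓi' hω) t]
    congr 1
    refine integral_congr_ae (ae_restrict_of_ae (CountingPath.ae_drivingMeasure_of ?_ ?_))
    · filter_upwards [hAA', ae_restrict_mem measurableSet_Ioc] with u hu huT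
      simp only [backwardGenerator, ℓ, min_eq_left huT.2, hu]
    · intro u hu
      simp only [backwardGenerator, ℓ, min_eq_left (CountingPath.mem_jumps.1 hu).2.1, if_true]
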